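/- Let $0<p<q$ with $p+q=1$, and let $U,V$ be the transition matrices on $\{0,1,2,\dots\}$ with $U_{j,j}=q$, $U_{j,j+1}=p$ $(j\ge 0)$, and $V_{0,0}=1$, $V_{j,j-1}=q$, $V_{j,j}=p$ $(j\ge1)$, all other entries being $0$. Put $\theta=\sqrt{1+4pq+16p^2q^2}$, $$u=1-2p+6p^2-8p^3+4p^4,\qquad v=1+6p^2-28p^3+54p^4-48p^5+16p^6,$$ $$a=6-5p,\quad b=15-24p+10p^2,\quad c=-(1-20p^3+45p^4-36p^5+10p^6),$$ $$d=-(1-15p^2+40p^3-45p^4+24p^5-5p^6),$$ $$D(z)=(q^2-p^2z)\left[q^4+q^2(1+4pq)z+(1+2pq+6p^2q^2)z^2+p^2(1+4pq)z^3+p^4z^4\right],$$ and, for reals $x_0,x_1,x_2$, $$N(z)=N_{x_0,x_1,x_2}(z)=\left\{p^4[b+apz+p^2z^2]x_0+[c+bp^4z+ap^5z^2+p^6z^3]x_1+[d+cz+bp^4z^2+ap^5z^3+p^6z^4]x_2\right\}z^3,$$ $$L(x_0,x_1,x_2)=\frac{3p^4(1+2q+2q^2)x_0-[3(q-p)-2(1+2p)q^5]x_1-[3(q-p)-q^6]x_2}{3(q-p)}.$$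 (i) The polynomial $D$ has degree $5$ and its zeros, with multiplicity, are $z_3=q^2/p^2>1$ and $$z_1,z_4=\frac{-1-i\sqrt3-4pq\pm\sqrt{-2+2i\sqrt3+8(1+i\sqrt3)pq}}{4p^2},\qquad z_2,z_5=\frac{-1+i\sqrt3-4pq\pm\sqrt{-2-2i\sqrt3+8(1-i\sqrt3)pq}}{4p^2}$$ (principal square roots; upper sign for $z_1,z_2$, lower sign for $z_4,z_5$). None of $z_1,z_2,z_4,z_5$ is real, $z_2=\overline{z_1}$, $z_5=\overline{z_4}$, $|z_1|=|z_2|<1$ and $|z_4|=|z_5|>1$. (ii) Real numbers $x_0,x_1,x_2$ satisfy the three equations $N(z_1)=0$, $N(z_2)=0$, $x_0+x_1+x_2+L(x_0,x_1,x_2)=1$ if and only if $x_0=\pi_0$, $x_1=\pi_1$, $x_2=\pi_2$ with the values displayed in (iii). (iii) The Markov chain with transition matrix $U^3V^3$ has exactly one stationary distribution $\pi=(\pi_j)_{j\ge0}$. With $N=N_{\pi_0,\pi_1,\pi_2}$, its generating function satisfies $\sum_{j\ge3}\pi_jz^j=N(z)/D(z)$ for all complex $z$ with $|z|\le1$, $D(z)\ne0$,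 and $\lim_{x\to1^-}\sum_{j\ge3}\pi_jx^j=L(\pi_0,\pi_1,\pi_2)$. Moreover $$\pi_0=\frac{q-p}{4q^6}\left[7-10p+4p^2+\theta-\sqrt2\sqrt{1+28p-60p^2+40p^3-8p^4+(7-10p+4p^2)\theta}\right],$$ $$\begin{aligned}\pi_1=\frac{q-p}{4q^7}\Big[&-3(1+7p-10p^2+4p^3)-3(1+p)\theta\\&+\sqrt6\sqrt{-1+30p+71p^2-84p^3-100p^4+120p^5-24p^6+(7+16p-5p^2-18p^3+12p^4)\theta}\Big],\end{aligned}$$ $$\begin{aligned}\pi_2=\frac{q-p}{4q^8}\Big[&3(-1+6p+14p^2-20p^3+8p^4)+3(1+4p+2p^2)\theta\\&-\sqrt6\,\big(-1-16p+64p^2+656p^3+52p^4-1072p^5+80p^6+480p^7-96p^8\\&\qquad+(1+14p+120p^2+80p^3-92p^4-24p^5+48p^6)\theta\big)^{1/2}\Big],\end{aligned}$$ and $$\pi_j\sim A(p)\left(\frac{p^2}{q^2}\right)^j\quad(j\to\infty),\qquad A(p)=-\frac{N(z_3)}{z_3D'(z_3)}=\frac{(q-p)u+(q-p)^3\theta+\sqrt2\,(q-p)^2\sqrt{v+u\theta}}{12q^6}.$$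 -/

import Mathlib

open Polynomial

noncomputable section

namespace TrafficLight

/-! ### The chain -/

/-- The transition matrix of one red step on the states `0, 1, 2, …`:
`j ↦ j` with probability `q` and `j ↦ j + 1` with probability `p`. -/
def U (p q : ℝ) : Matrix ℕ ℕ ℝ := fun i j =>
  if j = i then q else if j = i + 1 then p else 0

/-- The transition matrix of one green step on the states `0, 1, 2, …`:
`0 ↦ 0` surely, and for `j ≥ 1`, `j ↦ j - 1` with probability `q`
and `j ↦ j` with probability `p`. -/
def V (p q : ℝ) : Matrix ℕ ℕ ℝ := fun i j =>
  if i = 0 then (if j = 0 then 1 else 0)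
  else if j + 1 = i then q else if j = i then p else 0

/-- The product of infinite matrices. All the matrices it is used for have finitely many nonzero
entries in each row, so the sum is finite. -/
def mulInf (A B : Matrix ℕ ℕ ℝ) : Matrix ℕ ℕ ℝ := fun i k => ∑' j, A i j * B j k

/-- The powers of an infinite matrix. -/
def powInf (A : Matrix ℕ ℕ ℝ) : ℕ → Matrix ℕ ℕ ℝ
  | 0 => 1
  | n + 1 => mulInf (powInf A n) A

/-- The transition matrix `U³V³` of the subwalk. -/
def P (p q : ℝ) : Matrix ℕ ℕ ℝ := mulInf (powInf (U p q) 3) (powInf (V p q) 3)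

/-- `π` is a stationary distribution of the transition matrix `A`: a probability distribution on
`ℕ` with `π A = π`. -/
structure IsStationary (A : Matrix ℕ ℕ ℝ) (π : ℕ → ℝ) : Prop where
  nonneg : ∀ j, 0 ≤ π j
  hasSum_one : HasSum π 1
  invariant : ∀ k, HasSum (fun j => π j * A j k) (π k)

/-! ### The explicit formulas -/

/-- The inner radical `θ`. -/
def θ (p q : ℝ) : ℝ := √(1 + 4 * p * q + 16 * p ^ 2 * q ^ 2)

/-- The value of `π₀`. -/
def val0 (p q : ℝ) : ℝ :=
  (q - p) * (7 - 10 * p + 4 * p ^ 2 + θ p q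
    - √2 * √(1 + 28 * p - 60 * p ^ 2 + 40 * p ^ 3 - 8 * p ^ 4
        + (7 - 10 * p + 4 * p ^ 2) * θ p q)) / (4 * q ^ 6)

/-- The value of `π₁`. -/
def val1 (p q : ℝ) : ℝ :=
  (q - p) * (-3 * (1 + 7 * p - 10 * p ^ 2 + 4 * p ^ 3) - 3 * (1 + p) * θ p q
    + √6 * √(-1 + 30 * p + 71 * p ^ 2 - 84 * p ^ 3 - 100 * p ^ 4 + 120 * p ^ 5 - 24 * p ^ 6
        + (7 + 16 * p - 5 * p ^ 2 - 18 * p ^ 3 + 12 * p ^ 4) * θ p q)) / (4 * q ^ 7)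

/-- The value of `π₂`. -/
def val2 (p q : ℝ) : ℝ :=
  (q - p) * (3 * (-1 + 6 * p + 14 * p ^ 2 - 20 * p ^ 3 + 8 * p ^ 4)
    + 3 * (1 + 4 * p + 2 * p ^ 2) * θ p q
    - √6 * √(-1 - 16 * p + 64 * p ^ 2 + 656 * p ^ 3 + 52 * p ^ 4 - 1072 * p ^ 5 + 80 * p ^ 6
        + 480 * p ^ 7 - 96 * p ^ 8
        + (1 + 14 * p + 120 * p ^ 2 + 80 * p ^ 3 - 92 * p ^ 4 - 24 * p ^ 5 + 48 * p ^ 6)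
          * θ p q)) / (4 * q ^ 8)

/-- The polynomial `u` in the amplitude. -/
def u (p : ℝ) : ℝ := 1 - 2 * p + 6 * p ^ 2 - 8 * p ^ 3 + 4 * p ^ 4

/-- The polynomial `v` in the amplitude. -/
def v (p : ℝ) : ℝ := 1 + 6 * p ^ 2 - 28 * p ^ 3 + 54 * p ^ 4 - 48 * p ^ 5 + 16 * p ^ 6

/-- The amplitude `A(p)`. -/
def amp (p q : ℝ) : ℝ :=
  ((q - p) * u p + (q - p) ^ 3 * θ p q + √2 * (q - p) ^ 2 * √(v p + u p * θ p q)) / (12 * q ^ 6)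

/-! ### The generating function `F(z) = ∑_{j ≥ 3} π_j z^j = N(z) / D(z)` -/

/-- The coefficient `a`. -/
def ca (p : ℝ) : ℝ := 6 - 5 * p

/-- The coefficient `b`. -/
def cb (p : ℝ) : ℝ := 15 - 24 * p + 10 * p ^ 2

/-- The coefficient `c`. -/
def cc (p : ℝ) : ℝ := -(1 - 20 * p ^ 3 + 45 * p ^ 4 - 36 * p ^ 5 + 10 * p ^ 6)

/-- The coefficient `d`. -/
def cd (p : ℝ) : ℝ := -(1 - 15 * p ^ 2 + 40 * p ^ 3 - 45 * p ^ 4 + 24 * p ^ 5 - 5 * p ^ 6)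

/-- The numerator `N(z)`, in terms of the unknowns `x₀, x₁, x₂` (standing for `π₀, π₁, π₂`). -/
def N (p x₀ x₁ x₂ : ℝ) : ℝ[X] :=
  (C (p ^ 4) * (C (cb p) + C (ca p * p) * X + C (p ^ 2) * X ^ 2) * C x₀
    + (C (cc p) + C (cb p * p ^ 4) * X + C (ca p * p ^ 5) * X ^ 2 + C (p ^ 6) * X ^ 3) * C x₁
    + (C (cd p) + C (cc p) * X + C (cb p * p ^ 4) * X ^ 2 + C (ca p * p ^ 5) * X ^ 3
        + C (p ^ 6) * X ^ 4) * C x₂) * X ^ 3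

/-- The denominator `D(z)`, of degree five. -/
def D (p q : ℝ) : ℝ[X] :=
  (C (q ^ 2) - C (p ^ 2) * X)
    * (C (q ^ 4) + C (q ^ 2 * (1 + 4 * p * q)) * X
      + C (1 + 2 * p * q + 6 * p ^ 2 * q ^ 2) * X ^ 2
      + C (p ^ 2 * (1 + 4 * p * q)) * X ^ 3 + C (p ^ 4) * X ^ 4)

/-- The value `L` of `lim_{z → 1} F(z)`, in terms of the unknowns `x₀, x₁, x₂`. -/
def L (p q x₀ x₁ x₂ : ℝ) : ℝ :=
  (3 * p ^ 4 * (1 + 2 * q + 2 * q ^ 2) * x₀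
    - (3 * (q - p) - 2 * (1 + 2 * p) * q ^ 5) * x₁
    - (3 * (q - p) - q ^ 6) * x₂) / (3 * (q - p))

/-- The zero `z₁` of `D`. -/
def z₁ (p q : ℝ) : ℂ :=
  (-1 - Complex.I * (√3 : ℝ) - 4 * p * q
    + Complex.sqrt (-2 + 2 * Complex.I * (√3 : ℝ) + 8 * (1 + Complex.I * (√3 : ℝ)) * p * q))
    / (4 * p ^ 2)

/-- The zero `z₂` of `D`. -/
def z₂ (p q : ℝ) : ℂ :=
  (-1 + Complex.I * (√3 : ℝ) - 4 * p * q
    + Complex.sqrt (-2 - 2 * Complex.I * (√3 : ℝ) + 8 * (1 - Complex.I * (√3 : ℝ)) * p * q))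
    / (4 * p ^ 2)

/-- The real zero `z₃` of `D`. -/
def z₃ (p q : ℝ) : ℝ := q ^ 2 / p ^ 2

/-- The zero `z₄` of `D`. -/
def z₄ (p q : ℝ) : ℂ :=
  (-1 - Complex.I * (√3 : ℝ) - 4 * p * q
    - Complex.sqrt (-2 + 2 * Complex.I * (√3 : ℝ) + 8 * (1 + Complex.I * (√3 : ℝ)) * p * q))
    / (4 * p ^ 2)

/-- The zero `z₅` of `D`. -/
def z₅ (p q : ℝ) : ℂ :=
  (-1 + Complex.I * (√3 : ℝ) - 4 * p * q
    - Complex.sqrt (-2 - 2 * Complex.I * (√3 : ℝ) + 8 * (1 - Complex.I * (√3 : ℝ)) * p * q))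
    / (4 * p ^ 2)

end TrafficLight

end

namespace TrafficLight

/-! ### The transition matrix of the subwalk -/

/-! The three up-steps precede the three down-steps, so the truncation at `0` can be postponed to
the end: one step of `U³V³` sends `i` to `i + s - 3` in `ℕ`, with `s` binomial of parameters `6` and
`p` (`P_apply`).

Existence. Started at `0`, the chain has tails that increase with time and are dominated by `ζ ^ k`,
where `ζ = p² / q²` is the nontrivial solution of `(p + q ζ) ^ 6 = ζ ^ 3`. The limiting tails vanish
at infinity, and their differences form a stationary distribution (`exists_isStationary`).

Generating function. Let `Π` be the generating function of a stationary `π`. Stationarity says that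
`(z³ - (q + p z)⁶) Π(z)` is a boundary polynomial. Dividing by `z - 1` gives `D Π = num`, with `num`
of degree at most two and determined by `π 0`, `π 1`, `π 2` (`D_mul_mk_eq_num`). The roots of `D`
solve `(q + p z)² = ω z` with `ω³ = 1`; exactly the conjugate pair `z₁`, `z₂` lies in the open disk.
There `Π` converges, so `num = κ (z - z₁)(z - z₂)`, and `Π(1) = 1` fixes `κ`. This determines `π 0`,
`π 1`, `π 2`, hence `π`.

Closed forms. With `r = (p / q) |z₁|` and `e = (θ - 1) / 2`, one has `p² (z₁ + z₂) = -e r` and `p²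
z₁ z₂ = q² r²`, while `e` and `r` satisfy one quadratic relation each (`isParam_z₁`). Each outer
radical is a positive multiple of the gap `1 + e - 2pqr`, whose square is `1 + pq + e`; the
displayed formulas then reduce to polynomial identities modulo the two relations.

Asymptotics. The remaining roots are `1 / ζ`, `1 / (ζ z₁)`, `1 / (ζ z₂)`, so `Π(z) = π 0 / ((1 - ζ
z)(1 - ζ z₁ z)(1 - ζ z₂ z))`. Hence `π j / ζ ^ j` tends to `π 0 / ((1 - z₁)(1 - z₂))`, which is the
amplitude. -/

/-- The Kronecker delta on `ℕ` with real values. -/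
def kron (k m : ℕ) : ℝ := if k = m then 1 else 0

/-- The binomial weights with parameters `6` and `p`. -/
noncomputable def stepProb (p q : ℝ) (s : ℕ) : ℝ := (Nat.choose 6 s : ℝ) * p ^ s * q ^ (6 - s)

/-- The map `f` need not be injective: truncated subtraction makes several deltas of a row coincide
near `0`. -/
theorem mulInf_apply_of_row (A B : Matrix ℕ ℕ ℝ) (i : ℕ) (n : ℕ) (a : ℕ → ℝ) (f : ℕ → ℕ)
    (h : ∀ j, A i j = ∑ s ∈ Finset.range n, a s * kron j (f s)) (k : ℕ) :
    mulInf A B i k = ∑ s ∈ Finset.range n, a s * B (f s) k := by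
  have : HasSum (fun j => A i j * B j k) (∑ s ∈ Finset.range n, a s * B (f s) k) := by
    simp_rw [h, Finset.sum_mul]
    refine hasSum_sum fun s _ => ?_
    convert hasSum_ite_eq (f s) (a s * B (f s) k) using 2 with j
    by_cases hj : j = f s <;> simp [kron, hj]
  exact this.tsum_eq

theorem U_apply (p q : ℝ) (m k : ℕ) : U p q m k = q * kron k m + p * kron k (m + 1) := by
  unfold U kron
  split_ifs <;> first | omega | simp

/-- At `m = 0` both deltas sit at `0` and their weights add up to `1`, so truncated subtraction
covers the boundary row as well. -/
theorem V_apply {p q : ℝ} (hsum : p + q = 1) (m k : ℕ) :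
    V p q m k = q * kron k (m - 1) + p * kron k m := by
  unfold V kron
  split_ifs <;> first | omega | (simp; done) | (simp; linarith)

theorem powInf_U_three (p q : ℝ) (i k : ℕ) :
    powInf (U p q) 3 i k = q ^ 3 * kron k i + 3 * p * q ^ 2 * kron k (i + 1)
      + 3 * p ^ 2 * q * kron k (i + 2) + p ^ 3 * kron k (i + 3) := by
  have h1 : ∀ k, powInf (U p q) 1 i k = q * kron k i + p * kron k (i + 1) := fun k => by
    rw [powInf, mulInf_apply_of_row _ _ i 1 (fun _ => 1) (fun _ => i)]
    · simp [U_apply]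
    · intro j
      simp [powInf, Matrix.one_apply, kron, eq_comm]
  have h2 : ∀ k, powInf (U p q) 2 i k = q ^ 2 * kron k i + 2 * p * q * kron k (i + 1)
      + p ^ 2 * kron k (i + 2) := fun k => by
    rw [powInf, mulInf_apply_of_row _ _ i 2 (fun s => if s = 0 then q else p) (fun s => i + s)]
    · simp [Finset.sum_range_succ, U_apply]; ring
    · intro j
      simp [h1, Finset.sum_range_succ]
  rw [powInf, mulInf_apply_of_row _ _ i 3
    (fun s => if s = 0 then q ^ 2 else if s = 1 then 2 * p * q else p ^ 2) (fun s => i + s)]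
  · simp [Finset.sum_range_succ, U_apply, add_assoc]; ring
  · intro j
    simp [h2, Finset.sum_range_succ]

theorem powInf_V_three {p q : ℝ} (hsum : p + q = 1) (i k : ℕ) :
    powInf (V p q) 3 i k = p ^ 3 * kron k i + 3 * p ^ 2 * q * kron k (i - 1)
      + 3 * p * q ^ 2 * kron k (i - 2) + q ^ 3 * kron k (i - 3) := by
  have h1 : ∀ k, powInf (V p q) 1 i k = p * kron k i + q * kron k (i - 1) := fun k => by
    rw [powInf, mulInf_apply_of_row _ _ i 1 (fun _ => 1) (fun _ => i)]
    · simp [V_apply hsum]; ring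
    · intro j
      simp [powInf, Matrix.one_apply, kron, eq_comm]
  have h2 : ∀ k, powInf (V p q) 2 i k = p ^ 2 * kron k i + 2 * p * q * kron k (i - 1)
      + q ^ 2 * kron k (i - 2) := fun k => by
    rw [powInf, mulInf_apply_of_row _ _ i 2 (fun s => if s = 0 then p else q) (fun s => i - s)]
    · simp [Finset.sum_range_succ, V_apply hsum, Nat.sub_sub]; ring
    · intro j
      simp [h1, Finset.sum_range_succ]
  rw [powInf, mulInf_apply_of_row _ _ i 3
    (fun s => if s = 0 then p ^ 2 else if s = 1 then 2 * p * q else q ^ 2) (fun s => i - s)]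
  · simp [Finset.sum_range_succ, V_apply hsum, Nat.sub_sub]; ring
  · intro j
    simp [h2, Finset.sum_range_succ]

theorem P_apply {p q : ℝ} (hsum : p + q = 1) (i k : ℕ) :
    P p q i k = ∑ s ∈ Finset.range 7, stepProb p q s * kron k (i + s - 3) := by
  rw [P, mulInf_apply_of_row _ _ i 4
    (fun s => if s = 0 then q ^ 3 else if s = 1 then 3 * p * q ^ 2 else
      if s = 2 then 3 * p ^ 2 * q else p ^ 3) (fun s => i + s)]
  · have e1 : i + 1 - 2 = i - 1 := by omega
    have e2 : i + 1 - 3 = i - 2 := by omega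
    have e3 : i + 2 - 3 = i - 1 := by omega
    have e4 : i + 4 - 3 = i + 1 := by omega
    have e5 : i + 5 - 3 = i + 2 := by omega
    have e6 : i + 6 - 3 = i + 3 := by omega
    have e7 : i + 2 - 1 = i + 1 := by omega
    have e8 : i + 3 - 1 = i + 2 := by omega
    have e9 : i + 3 - 2 = i + 1 := by omega
    simp [Finset.sum_range_succ, powInf_V_three hsum, stepProb, e1, e2, e3, e4, e5, e6, e7, e8, e9,
      show Nat.choose 6 2 = 15 from rfl, show Nat.choose 6 3 = 20 from rfl,
      show Nat.choose 6 4 = 15 from rfl]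
    ring
  · intro j
    simp [powInf_U_three, Finset.sum_range_succ]

theorem sum_stepProb {p q : ℝ} (hsum : p + q = 1) :
    ∑ s ∈ Finset.range 7, stepProb p q s = 1 := by
  have h : (p + q) ^ 6 = ∑ s ∈ Finset.range 7, stepProb p q s := by
    rw [add_pow]
    exact Finset.sum_congr rfl fun s _ => by unfold stepProb; ring
  rw [← h, hsum, one_pow]

/-- The mass that a step of size `s - 3` brings to the state `k`. -/
def inflow (π : ℕ → ℝ) (k s : ℕ) : ℝ :=
  if k = 0 then ∑ j ∈ Finset.range (4 - s), π j else if s ≤ k + 3 then π (k + 3 - s) else 0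

theorem hasSum_inflow (π : ℕ → ℝ) (k s : ℕ) :
    HasSum (fun j => π j * kron k (j + s - 3)) (inflow π k s) := by
  unfold inflow
  split_ifs with h0 h1
  · subst h0
    -- The state `0` receives every `j` with `j + s ≤ 3`, that is `j < 4 - s`.
    have : ∑ j ∈ Finset.range (4 - s), π j
        = ∑ j ∈ Finset.range (4 - s), π j * kron 0 (j + s - 3) :=
      Finset.sum_congr rfl fun j hj => by
        rw [kron, if_pos (by rw [Finset.mem_range] at hj; omega), mul_one]
    rw [this]
    refine hasSum_sum_of_ne_finset_zero fun j hj => ?_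
    rw [kron, if_neg (by rw [Finset.mem_range] at hj; omega), mul_zero]
  · convert hasSum_ite_eq (k + 3 - s) (π (k + 3 - s)) using 2 with j
    by_cases hj : j = k + 3 - s
    · subst hj
      rw [kron, if_pos (by omega), if_pos rfl, mul_one]
    · rw [kron, if_neg (by omega), if_neg hj, mul_zero]
  · convert (hasSum_zero : HasSum (fun _ : ℕ => (0 : ℝ)) 0) using 2 with j
    rw [kron, if_neg (by omega), mul_zero]

theorem hasSum_mul_P {p q : ℝ} (hsum : p + q = 1) (π : ℕ → ℝ) (k : ℕ) :
    HasSum (fun j => π j * P p q j k)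
      (∑ s ∈ Finset.range 7, stepProb p q s * inflow π k s) := by
  have h := hasSum_sum (s := Finset.range 7) fun s _ =>
    (hasSum_inflow π k s).mul_left (stepProb p q s)
  have e : (fun j => π j * P p q j k)
      = fun j => ∑ s ∈ Finset.range 7, stepProb p q s * (π j * kron k (j + s - 3)) := by
    funext j
    rw [P_apply hsum, Finset.mul_sum]
    exact Finset.sum_congr rfl fun s _ => by ring
  rw [e]
  exact h

theorem invariant_iff {p q : ℝ} (hsum : p + q = 1) (π : ℕ → ℝ) :
    (∀ k, HasSum (fun j => π j * P p q j k) (π k)) ↔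
      ∀ k, ∑ s ∈ Finset.range 7, stepProb p q s * inflow π k s = π k :=
  forall_congr' fun k => ⟨fun h => (hasSum_mul_P hsum π k).unique h,
    fun h => h ▸ hasSum_mul_P hsum π k⟩

/-! ### Existence of a stationary distribution -/

theorem stepProb_nonneg {p q : ℝ} (hp : 0 < p) (hq : 0 < q) (s : ℕ) : 0 ≤ stepProb p q s := by
  unfold stepProb; positivity

/-- The tails of the distributions of the chain started at `0`. -/
noncomputable def tail (p q : ℝ) : ℕ → ℕ → ℝ
  | 0, k => if k = 0 then 1 else 0
  | n + 1, k => if k = 0 then 1 else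
      ∑ s ∈ Finset.range 7, stepProb p q s * tail p q n (k + 3 - s)

theorem tail_zero_right (p q : ℝ) (n : ℕ) : tail p q n 0 = 1 := by
  cases n <;> simp [tail]

theorem tail_succ_of_pos (p q : ℝ) (n : ℕ) {k : ℕ} (hk : k ≠ 0) :
    tail p q (n + 1) k = ∑ s ∈ Finset.range 7, stepProb p q s * tail p q n (k + 3 - s) := by
  rw [tail, if_neg hk]

theorem tail_nonneg {p q : ℝ} (hp : 0 < p) (hq : 0 < q) (n k : ℕ) : 0 ≤ tail p q n k := by
  induction n generalizing k with
  | zero => unfold tail; positivity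
  | succ n ih =>
    unfold tail
    split_ifs
    · exact zero_le_one
    · exact Finset.sum_nonneg fun s _ => mul_nonneg (stepProb_nonneg hp hq s) (ih _)

/-- The start at `0` is the lowest possible one, and the recursion preserves the order. -/
theorem tail_le_succ {p q : ℝ} (hp : 0 < p) (hq : 0 < q) (n k : ℕ) :
    tail p q n k ≤ tail p q (n + 1) k := by
  rcases eq_or_ne k 0 with rfl | hk
  · simp only [tail_zero_right, le_refl]
  induction n generalizing k with
  | zero =>
    rw [tail, if_neg hk]
    exact tail_nonneg hp hq _ _
  | succ n ih =>
    rw [tail_succ_of_pos _ _ _ hk, tail_succ_of_pos _ _ _ hk]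
    refine Finset.sum_le_sum fun s _ => mul_le_mul_of_nonneg_left ?_ (stepProb_nonneg hp hq s)
    rcases eq_or_ne (k + 3 - s) 0 with h | h
    · simp only [h, tail_zero_right, le_refl]
    · exact ih _ h

theorem tail_le_one {p q : ℝ} (hp : 0 < p) (hq : 0 < q) (hsum : p + q = 1) (n k : ℕ) :
    tail p q n k ≤ 1 := by
  induction n generalizing k with
  | zero => unfold tail; split_ifs <;> norm_num
  | succ n ih =>
    unfold tail
    split_ifs
    · exact le_rfl
    · rw [← sum_stepProb hsum]
      exact Finset.sum_le_sum fun s _ =>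
        mul_le_of_le_one_right (stepProb_nonneg hp hq s) (ih _)

theorem tail_antitone {p q : ℝ} (hp : 0 < p) (hq : 0 < q) (hsum : p + q = 1) (n : ℕ) :
    Antitone (tail p q n) := by
  refine antitone_nat_of_succ_le fun k => ?_
  induction n generalizing k with
  | zero => cases k <;> simp [tail]
  | succ n ih =>
    rcases eq_or_ne k 0 with rfl | hk
    · rw [tail_zero_right]
      exact tail_le_one hp hq hsum _ _
    · rw [tail_succ_of_pos _ _ _ hk, tail_succ_of_pos _ _ _ k.succ_ne_zero]
      exact Finset.sum_le_sum fun s _ => mul_le_mul_of_nonneg_left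
        (antitone_nat_of_succ_le ih (by omega)) (stepProb_nonneg hp hq s)

/-- By the binomial theorem the sum is `ζ ^ m (p + q ζ) ^ 6`, and `p + q ζ = p / q`, whose square is
`ζ`. The exponents are shifted by three to stay in `ℕ`. -/
theorem sum_stepProb_mul_pow {p q : ℝ} (hp : 0 < p) (hq : 0 < q) (hsum : p + q = 1) (m : ℕ) :
    ∑ s ∈ Finset.range 7, stepProb p q s * ((p ^ 2 / q ^ 2) ^ (m + 6 - s))
      = (p ^ 2 / q ^ 2) ^ (m + 3) := by
  have e : ∀ s ∈ Finset.range 7, stepProb p q s * ((p ^ 2 / q ^ 2) ^ (m + 6 - s))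
      = (p ^ 2 / q ^ 2) ^ m
        * (p ^ s * (p ^ 2 * q / q ^ 2) ^ (6 - s) * (Nat.choose 6 s : ℝ)) := fun s hs => by
    have hs' : s ≤ 6 := by rw [Finset.mem_range] at hs; omega
    rw [show m + 6 - s = m + (6 - s) by omega, pow_add, stepProb, mul_comm (p ^ 2) q,
      mul_div_assoc, mul_pow]
    ring
  rw [Finset.sum_congr rfl e, ← Finset.mul_sum, ← add_pow, pow_add]
  congr 1
  have : p + p ^ 2 * q / q ^ 2 = p / q := by
    field_simp
    linear_combination hsum
  rw [this]
  ring

theorem tail_le_pow {p q : ℝ} (hp : 0 < p) (hpq : p < q) (hsum : p + q = 1) (n k : ℕ) :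
    tail p q n k ≤ (p ^ 2 / q ^ 2) ^ k := by
  have hq : 0 < q := hp.trans hpq
  have hζ0 : 0 < p ^ 2 / q ^ 2 := by positivity
  have hζ1 : p ^ 2 / q ^ 2 ≤ 1 := by
    rw [div_le_one (by positivity)]; gcongr
  induction n generalizing k with
  | zero =>
    unfold tail
    split_ifs with h
    · simp [h]
    · positivity
  | succ n ih =>
    rcases eq_or_ne k 0 with rfl | hk
    · simp [tail_zero_right]
    rw [tail_succ_of_pos _ _ _ hk]
    refine le_of_mul_le_mul_right ?_ (pow_pos hζ0 3)
    rw [← pow_add, ← sum_stepProb_mul_pow hp hq hsum k, Finset.sum_mul]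
    refine Finset.sum_le_sum (fun s _ => ?_ : ∀ s ∈ Finset.range 7, _ ≤ _)
    rw [mul_assoc]
    refine mul_le_mul_of_nonneg_left ?_ (stepProb_nonneg hp hq s)
    calc tail p q n (k + 3 - s) * (p ^ 2 / q ^ 2) ^ 3
        ≤ (p ^ 2 / q ^ 2) ^ (k + 3 - s) * (p ^ 2 / q ^ 2) ^ 3 := by gcongr; exact ih _
      _ = (p ^ 2 / q ^ 2) ^ (k + 3 - s + 3) := by rw [pow_add]
      -- Truncation can only raise the exponent on the left, and the base is at most `1`.
      _ ≤ (p ^ 2 / q ^ 2) ^ (k + 6 - s) := pow_le_pow_of_le_one hζ0.le hζ1 (by omega)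

theorem exists_isStationary {p q : ℝ} (hp : 0 < p) (hpq : p < q) (hsum : p + q = 1) :
    ∃ π, IsStationary (P p q) π := by
  have hq : 0 < q := hp.trans hpq
  have hmono : ∀ k, Monotone fun n => tail p q n k := fun k =>
    monotone_nat_of_le_succ fun n => tail_le_succ hp hq n k
  have hlim : ∀ k, ∃ t, Filter.Tendsto (fun n => tail p q n k) Filter.atTop (nhds t) := fun k =>
    ⟨_, tendsto_atTop_ciSup (hmono k) ⟨1, by rintro _ ⟨n, rfl⟩; exact tail_le_one hp hq hsum n k⟩⟩
  choose T hT using hlim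
  have hT0 : T 0 = 1 := by
    refine tendsto_nhds_unique (hT 0) ?_
    simp only [tail_zero_right]
    exact tendsto_const_nhds
  have hTrec : ∀ k, T (k + 1) = ∑ s ∈ Finset.range 7, stepProb p q s * T (k + 4 - s) := fun k => by
    refine tendsto_nhds_unique ((hT (k + 1)).comp (Filter.tendsto_add_atTop_nat 1)) ?_
    refine (tendsto_finsetSum (Finset.range 7) fun s _ =>
      (hT (k + 4 - s)).const_mul (stepProb p q s)).congr fun n => ?_
    exact (tail_succ_of_pos _ _ _ k.succ_ne_zero).symm
  have hTanti : ∀ k, T (k + 1) ≤ T k := fun k =>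
    le_of_tendsto_of_tendsto' (hT _) (hT _) fun n => tail_antitone hp hq hsum n k.le_succ
  have hTle : ∀ k, T k ≤ (p ^ 2 / q ^ 2) ^ k := fun k =>
    le_of_tendsto' (hT k) fun n => tail_le_pow hp hpq hsum n k
  have hTge : ∀ k, 0 ≤ T k := fun k => ge_of_tendsto' (hT k) fun n => tail_nonneg hp hq n k
  have hTzero : Filter.Tendsto T Filter.atTop (nhds 0) := by
    refine squeeze_zero hTge hTle (tendsto_pow_atTop_nhds_zero_of_lt_one (by positivity) ?_)
    rw [div_lt_one (by positivity)]
    gcongr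
  have hpart : ∀ n, ∑ j ∈ Finset.range n, (T j - T (j + 1)) = 1 - T n := fun n => by
    rw [Finset.sum_range_sub', hT0]
  -- The inflow telescopes; for `k = 0` it collects all of `T 0 - T (4 - s)`.
  have hinflow : ∀ k s, inflow (fun j => T j - T (j + 1)) k s
      = (if k = 0 then 1 else T (k + 3 - s)) - T (k + 4 - s) := fun k s => by
    unfold inflow
    split_ifs with h0 h1
    · rw [hpart, h0, zero_add]
    · beta_reduce
      rw [show k + 3 - s + 1 = k + 4 - s by omega]
    · rw [show k + 3 - s = 0 by omega, show k + 4 - s = 0 by omega, sub_self]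
  refine ⟨fun j => T j - T (j + 1), fun j => sub_nonneg.2 (hTanti j), ?_,
    (invariant_iff hsum _).2 fun k => ?_⟩
  · rw [hasSum_iff_tendsto_nat_of_nonneg fun j => sub_nonneg.2 (hTanti j)]
    simp_rw [hpart]
    simpa using hTzero.const_sub 1
  · simp_rw [hinflow, mul_sub, Finset.sum_sub_distrib, ← hTrec]
    rcases k with _ | k
    · simp [sum_stepProb hsum, hT0]
    · simp [hTrec k]

/-! ### The generating function of a stationary distribution -/

/-- The generating function of the increments of the chain, shifted by three. -/
noncomputable def stepPoly (p q : ℝ) : ℝ[X] := (C q + C p * X) ^ 6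

/-- The product of `D` and the generating function of the stationary distribution, in terms of the
first three values of the latter. -/
noncomputable def num (p q x₀ x₁ x₂ : ℝ) : ℝ[X] :=
  C (q ^ 6 * x₀) + C (q ^ 6 * x₀ + (q ^ 6 * x₁ + 6 * p * q ^ 5 * x₀)) * X
    + C (q ^ 6 * x₀ + (q ^ 6 * x₁ + 6 * p * q ^ 5 * x₀)
      + (q ^ 6 * x₂ + 6 * p * q ^ 5 * x₁ + 15 * p ^ 2 * q ^ 4 * x₀)) * X ^ 2

theorem X_pow_three_sub_stepPoly {p q : ℝ} (hsum : p + q = 1) :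
    X ^ 3 - stepPoly p q = (X - 1) * D p q := by
  obtain rfl : q = 1 - p := by linarith
  simp only [stepPoly, D, map_mul, map_pow, map_add, map_sub, map_one, map_ofNat]
  ring

theorem N_eq {p q : ℝ} (hsum : p + q = 1) (x₀ x₁ x₂ : ℝ) :
    N p x₀ x₁ x₂ = num p q x₀ x₁ x₂ - D p q * (C x₀ + C x₁ * X + C x₂ * X ^ 2) := by
  obtain rfl : q = 1 - p := by linarith
  simp only [N, ca, cb, cc, cd, num, D, map_mul, map_pow, map_add, map_sub, map_neg, map_one,
    map_ofNat]
  ring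

theorem coe_stepPoly_mul (p q : ℝ) (f : PowerSeries ℝ) :
    (stepPoly p q : PowerSeries ℝ) * f
      = ∑ s ∈ Finset.range 7, PowerSeries.C (stepProb p q s) * (PowerSeries.X ^ s * f) := by
  rw [stepPoly, add_comm, add_pow]
  simp only [Finset.sum_range_succ, Finset.sum_range_zero, coe_add, coe_mul, coe_pow, coe_C, coe_X,
    stepProb, map_mul, map_pow, coe_zero, ← C_eq_natCast]
  ring

theorem coeff_stepPoly_mul (p q : ℝ) (π : ℕ → ℝ) (n : ℕ) :
    PowerSeries.coeff n ((stepPoly p q : PowerSeries ℝ) * PowerSeries.mk π)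
      = ∑ s ∈ Finset.range 7, stepProb p q s * if s ≤ n then π (n - s) else 0 := by
  rw [coe_stepPoly_mul, map_sum]
  simp only [PowerSeries.coeff_C_mul, PowerSeries.coeff_X_pow_mul', PowerSeries.coeff_mk]

theorem coeff_X_pow_three_mul_C_sub (a b c d : ℝ) (n : ℕ) :
    (X ^ 3 * C d - (C a + C b * X + C c * X ^ 2)).coeff n
      = if n = 0 then -a else if n = 1 then -b else if n = 2 then -c else
        if n = 3 then d else 0 := by
  simp only [coeff_sub, coeff_add, coeff_X_pow_mul', coeff_C_mul, coeff_X, coeff_C, coeff_X_pow]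
  match n with
  | 0 | 1 | 2 | 3 => simp
  | k + 4 => simp

/-- After multiplication by `X - 1`, the left side becomes `(X³ - stepPoly) Π`, whose coefficients
compare `π k` with the untruncated inflow. -/
theorem D_mul_mk_eq_num {p q : ℝ} (hsum : p + q = 1) {π : ℕ → ℝ}
    (h : ∀ k, HasSum (fun j => π j * P p q j k) (π k)) :
    (D p q : PowerSeries ℝ) * PowerSeries.mk π = num p q (π 0) (π 1) (π 2) := by
  have hX : (PowerSeries.X - 1 : PowerSeries ℝ) ≠ 0 := fun h0 => by
    simpa using congrArg (PowerSeries.coeff 1) h0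
  have hfac := congrArg (fun f : ℝ[X] => (f : PowerSeries ℝ)) (X_pow_three_sub_stepPoly hsum)
  simp only [coe_mul, coe_sub, coe_pow, coe_X, coe_one] at hfac
  refine mul_left_cancel₀ hX ?_
  rw [← mul_assoc, ← hfac, sub_mul]
  have hinv := (invariant_iff hsum π).1 h
  have e1 : (X - 1 : ℝ[X]) * num p q (π 0) (π 1) (π 2)
      = X ^ 3 * C (q ^ 6 * π 0 + (q ^ 6 * π 1 + 6 * p * q ^ 5 * π 0)
          + (q ^ 6 * π 2 + 6 * p * q ^ 5 * π 1 + 15 * p ^ 2 * q ^ 4 * π 0))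
        - (C (q ^ 6 * π 0) + C (q ^ 6 * π 1 + 6 * p * q ^ 5 * π 0) * X
          + C (q ^ 6 * π 2 + 6 * p * q ^ 5 * π 1 + 15 * p ^ 2 * q ^ 4 * π 0) * X ^ 2) := by
    simp only [num, map_add]
    ring
  have e2 := congrArg (fun f : ℝ[X] => (f : PowerSeries ℝ)) e1
  rw [coe_mul, coe_sub, coe_one, coe_X] at e2
  rw [e2]
  ext n
  rw [map_sub, coeff_stepPoly_mul, PowerSeries.coeff_X_pow_mul', PowerSeries.coeff_mk, coeff_coe,
    coeff_X_pow_three_mul_C_sub]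
  have c2 : Nat.choose 6 2 = 15 := rfl
  -- Degrees `0, 1, 2` are the mass overshooting below `0`, degree `3` is the balance at state `0`,
  -- which recovers that mass, and degree `k + 4` is the balance at state `k + 1`.
  match n with
  | 0 => simp [stepProb]
  | 1 =>
    simp [Finset.sum_range_succ, stepProb]
  | 2 =>
    simp [Finset.sum_range_succ, stepProb, c2]
  | 3 =>
    have h0 := hinv 0
    simp [Finset.sum_range_succ, stepProb, inflow, c2] at h0
    simp [Finset.sum_range_succ, stepProb, c2]
    linear_combination -h0
  | k + 4 =>
    have h0 := hinv (k + 1)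
    simp only [inflow, Nat.succ_ne_zero, if_false, add_assoc, Nat.reduceAdd] at h0
    rw [h0]
    simp

theorem hasSum_coeff_mul {π : ℕ → ℝ} {z S : ℂ} (h : HasSum (fun n => (π n : ℂ) * z ^ n) S)
    (f : ℝ[X]) :
    HasSum
      (fun n => ((PowerSeries.coeff n ((f : PowerSeries ℝ) * PowerSeries.mk π) : ℝ) : ℂ) * z ^ n)
      (aeval z f * S) := by
  induction f using Polynomial.induction_on' with
  | add f g hf hg =>
    simp only [coe_add, add_mul, map_add, Complex.ofReal_add]
    exact hf.add hg
  | monomial m a =>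
    rw [← C_mul_X_pow_eq_monomial]
    simp only [coe_mul, coe_pow, coe_C, coe_X, mul_assoc, PowerSeries.coeff_C_mul,
      PowerSeries.coeff_X_pow_mul', PowerSeries.coeff_mk, map_mul, map_pow, aeval_C, aeval_X,
      Complex.ofReal_mul, Complex.coe_algebraMap]
    refine HasSum.mul_left _ ?_
    rw [← hasSum_nat_add_iff' m, Finset.sum_eq_zero, sub_zero]
    · convert h.mul_left (z ^ m) using 2 with n
      · rfl
      · simp
        ring
    · intro i hi
      rw [if_neg (by simpa using hi)]
      simp

/-- Only convergence of the series of `π` at `z` is needed, so the identity also reaches the unit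
circle. -/
theorem aeval_eq_of_mk_mul_eq {π : ℕ → ℝ} {z S : ℂ} (h : HasSum (fun n => (π n : ℂ) * z ^ n) S)
    {f g : ℝ[X]} (hfg : (f : PowerSeries ℝ) * PowerSeries.mk π = g) :
    aeval z f * S = aeval z g := by
  have h1 := hasSum_coeff_mul h f
  rw [hfg] at h1
  refine h1.unique ?_
  -- The constant series `1` in the role of `π` evaluates the polynomial `g` itself.
  have h2 : HasSum (fun n => ((if n = 0 then (1 : ℝ) else 0 : ℝ) : ℂ) * z ^ n) 1 := by
    convert hasSum_ite_eq 0 (1 : ℂ) using 2 with n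
    by_cases hn : n = 0 <;> simp [hn]
  have h3 := hasSum_coeff_mul h2 g
  have h4 : (PowerSeries.mk fun n => if n = 0 then (1 : ℝ) else 0) = 1 := by
    ext n; simp [PowerSeries.coeff_one]
  rwa [h4, mul_one, mul_one] at h3

/-! ### The zeros of the denominator -/

theorem complex_sqrt_sq (a : ℂ) : Complex.sqrt a ^ 2 = a := by
  rw [Complex.sqrt, ← Nat.cast_ofNat (R := ℂ), Complex.cpow_nat_inv_pow a two_ne_zero]

theorem complex_sqrt_re_nonneg (a : ℂ) : 0 ≤ (Complex.sqrt a).re := by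
  rw [Complex.sqrt, Complex.cpow_inv_two_re]
  exact Real.sqrt_nonneg _

theorem complex_sqrt_conj {a : ℂ} (h : 0 < (Complex.sqrt a).re) :
    Complex.sqrt ((starRingEnd ℂ) a) = (starRingEnd ℂ) (Complex.sqrt a) := by
  have h1 : Complex.sqrt ((starRingEnd ℂ) a) ^ 2 = ((starRingEnd ℂ) (Complex.sqrt a)) ^ 2 := by
    rw [complex_sqrt_sq, ← map_pow, complex_sqrt_sq]
  rcases sq_eq_sq_iff_eq_or_eq_neg.1 h1 with h2 | h2
  · exact h2
  · have h3 := complex_sqrt_re_nonneg ((starRingEnd ℂ) a)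
    rw [h2, Complex.neg_re, Complex.conj_re] at h3
    linarith

/-- The radicand in `z₁` and `z₄`. -/
noncomputable def radicand (p q : ℝ) : ℂ :=
  -2 + 2 * Complex.I * (√3 : ℝ) + 8 * (1 + Complex.I * (√3 : ℝ)) * p * q

theorem conj_radicand (p q : ℝ) : (starRingEnd ℂ) (radicand p q)
    = -2 - 2 * Complex.I * (√3 : ℝ) + 8 * (1 - Complex.I * (√3 : ℝ)) * p * q := by
  simp only [radicand, map_add, map_mul, map_neg, map_ofNat, map_one, Complex.conj_I,
    Complex.conj_ofReal]
  ring

/-- The radicand has positive imaginary part `2 Re(S) Im(S)`, where `S` is its principal root, and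
`Re(S) ≥ 0`. -/
theorem sqrt_radicand_pos {p q : ℝ} (hp : 0 < p) (hq : 0 < q) :
    0 < (Complex.sqrt (radicand p q)).re ∧ 0 < (Complex.sqrt (radicand p q)).im := by
  have h0 := complex_sqrt_re_nonneg (radicand p q)
  have h1 := congrArg Complex.im (complex_sqrt_sq (radicand p q))
  have h2 : (radicand p q).im = √3 * (2 + 8 * (p * q)) := by
    simp [radicand]; ring
  rw [h2, sq, Complex.mul_im] at h1
  have h3 : 0 < √3 * (2 + 8 * (p * q)) := by positivity
  have h4 : 0 < (Complex.sqrt (radicand p q)).re * (Complex.sqrt (radicand p q)).im := by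
    linarith
  have h5 : 0 < (Complex.sqrt (radicand p q)).re :=
    lt_of_le_of_ne h0 fun h => by rw [← h, zero_mul] at h4; exact lt_irrefl _ h4
  exact ⟨h5, (mul_pos_iff_of_pos_left h5).1 h4⟩

theorem z₂_eq_conj {p q : ℝ} (hp : 0 < p) (hq : 0 < q) :
    z₂ p q = (starRingEnd ℂ) (z₁ p q) := by
  rw [z₂, z₁, ← radicand, ← conj_radicand, complex_sqrt_conj (sqrt_radicand_pos hp hq).1]
  simp only [map_add, map_sub, map_mul, map_neg, map_ofNat, map_one, Complex.conj_I, map_div₀,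
    Complex.conj_ofReal, map_pow]
  ring

theorem z₅_eq_conj {p q : ℝ} (hp : 0 < p) (hq : 0 < q) :
    z₅ p q = (starRingEnd ℂ) (z₄ p q) := by
  rw [z₅, z₄, ← radicand, ← conj_radicand, complex_sqrt_conj (sqrt_radicand_pos hp hq).1]
  simp only [map_sub, map_mul, map_neg, map_ofNat, map_one, Complex.conj_I, map_div₀,
    Complex.conj_ofReal, map_pow]
  ring

theorem sq_I_mul_sqrt_three : (Complex.I * (√3 : ℝ)) ^ 2 = -3 := by
  rw [mul_pow, Complex.I_sq, ← Complex.ofReal_pow, Real.sq_sqrt (by norm_num)]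
  norm_num

theorem z₁_add_z₄ {p : ℝ} (q : ℝ) (hp : p ≠ 0) :
    (p : ℂ) ^ 2 * (z₁ p q + z₄ p q) = -(2 * p * q + (1 + Complex.I * (√3 : ℝ)) / 2) := by
  have hp' : (p : ℂ) ≠ 0 := Complex.ofReal_ne_zero.2 hp
  rw [z₁, z₄]
  field_simp
  ring

theorem z₁_mul_z₄ {p : ℝ} (q : ℝ) (hp : p ≠ 0) :
    (p : ℂ) ^ 2 * (z₁ p q * z₄ p q) = q ^ 2 := by
  have hp' : (p : ℂ) ≠ 0 := Complex.ofReal_ne_zero.2 hp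
  have h1 := complex_sqrt_sq (radicand p q)
  have h2 : (p : ℂ) ^ 2 * (z₁ p q * z₄ p q)
      = ((-1 - Complex.I * (√3 : ℝ) - 4 * p * q) ^ 2 - Complex.sqrt (radicand p q) ^ 2)
        / (16 * p ^ 2) := by
    rw [z₁, z₄, ← radicand]
    field_simp
    ring
  rw [h2, h1, div_eq_iff (by simp [hp]), radicand]
  linear_combination sq_I_mul_sqrt_three

/-- Here `ω = (-1 - i√3) / 2` is a primitive cube root of unity; `z₁` and `z₄` are the two roots for
this `ω`. -/
theorem z₁_quadratic {p : ℝ} (q : ℝ) (hp : p ≠ 0) :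
    (q + p * z₁ p q) ^ 2 = (-1 - Complex.I * (√3 : ℝ)) / 2 * z₁ p q := by
  linear_combination z₁ p q * z₁_add_z₄ q hp - z₁_mul_z₄ q hp

theorem z₄_quadratic {p : ℝ} (q : ℝ) (hp : p ≠ 0) :
    (q + p * z₄ p q) ^ 2 = (-1 - Complex.I * (√3 : ℝ)) / 2 * z₄ p q := by
  linear_combination z₄ p q * z₁_add_z₄ q hp - z₁_mul_z₄ q hp

theorem im_ne_zero_of_quadratic {p q : ℝ} (hq : q ≠ 0) {z : ℂ}
    (h : (q + p * z) ^ 2 = (-1 - Complex.I * (√3 : ℝ)) / 2 * z) : z.im ≠ 0 := fun h0 => by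
  obtain ⟨x, y⟩ := z
  obtain rfl : y = 0 := h0
  have h1 : (⟨x, 0⟩ : ℂ) = (x : ℂ) := rfl
  rw [h1] at h
  have h2 := congrArg Complex.im h
  have h3 : (((q : ℂ) + p * x) ^ 2).im = 0 := by
    rw [← Complex.ofReal_mul, ← Complex.ofReal_add, ← Complex.ofReal_pow, Complex.ofReal_im]
  have h4 : ((-1 - Complex.I * (√3 : ℝ)) / 2 * (x : ℂ)).im = -√3 / 2 * x := by
    simp
  rw [h3, h4] at h2
  have h5 : x = 0 := by
    have : (0 : ℝ) < √3 := by positivity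
    nlinarith
  rw [h5] at h
  simp at h
  exact hq h

theorem normSq_add_mul_of_quadratic {p q : ℝ} {z : ℂ}
    (h : (q + p * z) ^ 2 = (-1 - Complex.I * (√3 : ℝ)) / 2 * z) :
    Complex.normSq (q + p * z) = ‖z‖ := by
  have h1 := congrArg norm h
  have h2 : ‖(-1 - Complex.I * (√3 : ℝ)) / 2‖ = 1 := by
    rw [← sq_eq_sq₀ (norm_nonneg _) zero_le_one, ← Complex.normSq_eq_norm_sq, Complex.normSq_apply]
    have h3 : √3 * √3 = 3 := Real.mul_self_sqrt (by norm_num)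
    simp
    linear_combination h3 / 4
  rw [norm_pow, norm_mul, h2, one_mul] at h1
  rw [Complex.normSq_eq_norm_sq, h1]

/-- The numerators are `A + S` and `A - S`, where `A` has both parts negative and `S` both positive.
-/
theorem norm_z₁_lt_norm_z₄ {p q : ℝ} (hp : 0 < p) (hq : 0 < q) : ‖z₁ p q‖ < ‖z₄ p q‖ := by
  obtain ⟨h1, h2⟩ := sqrt_radicand_pos hp hq
  rw [z₁, z₄, ← radicand, norm_div, norm_div]
  have h3 : 0 < ‖(4 * p ^ 2 : ℂ)‖ := norm_pos_iff.2 (by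
    simp [hp.ne'])
  refine div_lt_div_of_pos_right ?_ h3
  rw [← sq_lt_sq₀ (norm_nonneg _) (norm_nonneg _), ← Complex.normSq_eq_norm_sq,
    ← Complex.normSq_eq_norm_sq, Complex.normSq_apply, Complex.normSq_apply]
  have h4 : 0 < √3 * (Complex.sqrt (radicand p q)).im := by positivity
  have h5 : 0 < p * q * (Complex.sqrt (radicand p q)).re := by positivity
  simp
  nlinarith

theorem norm_z₁_mul_norm_z₄ {p q : ℝ} (hp : 0 < p) :
    p ^ 2 * (‖z₁ p q‖ * ‖z₄ p q‖) = q ^ 2 := by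
  have h := congrArg norm (z₁_mul_z₄ q hp.ne')
  simpa using h

theorem mul_norm_z₁_lt {p q : ℝ} (hp : 0 < p) (hq : 0 < q) : p * ‖z₁ p q‖ < q := by
  have h1 := norm_z₁_lt_norm_z₄ hp hq
  have h2 := norm_z₁_mul_norm_z₄ (q := q) hp
  refine lt_of_pow_lt_pow_left₀ 2 hq.le ?_
  rcases (norm_nonneg (z₁ p q)).eq_or_lt with h0 | h0
  · rw [← h0]; simpa using pow_pos hq 2
  · rw [← h2, mul_pow, sq ‖_‖]
    gcongr

/-- Put `r = ‖z₁‖`. Since `z₁` is not a nonnegative real, `r = |q + p z₁|² < (q + p r)²`, that is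
`(r - 1)(p² r - q²) > 0`. As `p r < q` makes the second factor negative, `r ≥ 1` is impossible. -/
theorem norm_z₁_lt_one {p q : ℝ} (hp : 0 < p) (hpq : p < q) (hsum : p + q = 1) :
    ‖z₁ p q‖ < 1 := by
  have hq := hp.trans hpq
  have hquad := z₁_quadratic q hp.ne'
  have him := im_ne_zero_of_quadratic hq.ne' hquad
  have h1 := normSq_add_mul_of_quadratic hquad
  have h2 := mul_norm_z₁_lt hp hq
  have h3 : Complex.normSq (z₁ p q) = ‖z₁ p q‖ ^ 2 := Complex.normSq_eq_norm_sq _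
  have h4 : |(z₁ p q).re| ≤ ‖z₁ p q‖ := Complex.abs_re_le_norm _
  have h5 : (z₁ p q).re < ‖z₁ p q‖ := by
    refine lt_of_le_of_ne ((le_abs_self _).trans h4) fun h => him ?_
    rw [Complex.normSq_apply, ← h] at h3
    nlinarith
  rw [Complex.normSq_apply] at h1 h3
  simp at h1
  by_contra! hge
  generalize ‖z₁ p q‖ = r at *
  generalize (z₁ p q).re = x at *
  generalize (z₁ p q).im = y at *
  have h6 : q ^ 2 + 2 * (p * q) * x + p ^ 2 * r ^ 2 = r := by
    linear_combination h1 - p ^ 2 * h3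
  have h7 : 0 < p * q * (r - x) := by have := sub_pos.2 h5; positivity
  have h8 : 0 < (r - 1) * (p ^ 2 * r - q ^ 2) := by
    obtain rfl : q = 1 - p := by linarith
    nlinarith
  have h9 : p ^ 2 * r - q ^ 2 < 0 := by nlinarith
  nlinarith

theorem one_lt_norm_z₄ {p q : ℝ} (hp : 0 < p) (hpq : p < q) (hsum : p + q = 1) :
    1 < ‖z₄ p q‖ := by
  have h1 := norm_z₁_lt_one hp hpq hsum
  have h2 := norm_z₁_mul_norm_z₄ (q := q) hp
  by_contra! h
  have h3 : ‖z₁ p q‖ * ‖z₄ p q‖ ≤ 1 := mul_le_one₀ h1.le (norm_nonneg _) h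
  nlinarith [pow_pos hp 2]

theorem one_lt_z₃ {p q : ℝ} (hp : 0 < p) (hpq : p < q) : 1 < z₃ p q := by
  rw [z₃, one_lt_div (by positivity)]
  gcongr

theorem map_D_eq {p q : ℝ} (hp : 0 < p) (hq : 0 < q) :
    (D p q).map (algebraMap ℝ ℂ) = C (-(p : ℂ) ^ 6)
      * ((X - C (z₁ p q)) * (X - C (z₂ p q)) * (X - C ((z₃ p q : ℝ) : ℂ))
        * (X - C (z₄ p q)) * (X - C (z₅ p q))) := by
  have hp' : (p : ℂ) ≠ 0 := Complex.ofReal_ne_zero.2 hp.ne'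
  have e1 := z₁_add_z₄ q hp.ne'
  have e2 := z₁_mul_z₄ q hp.ne'
  have e3 : (p : ℂ) ^ 2 * (z₂ p q + z₅ p q)
      = -(2 * p * q + (1 - Complex.I * (√3 : ℝ)) / 2) := by
    have := congrArg (starRingEnd ℂ) e1
    simp only [map_add, map_mul, map_neg, map_ofNat, map_one, Complex.conj_I, map_div₀,
      Complex.conj_ofReal, map_pow, ← z₂_eq_conj hp hq, ← z₅_eq_conj hp hq] at this
    rw [this]; ring
  have e4 : (p : ℂ) ^ 2 * (z₂ p q * z₅ p q) = q ^ 2 := by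
    have := congrArg (starRingEnd ℂ) e2
    simpa only [map_mul, Complex.conj_ofReal, map_pow, ← z₂_eq_conj hp hq, ← z₅_eq_conj hp hq]
      using this
  have e5 : (p : ℂ) ^ 2 * ((z₃ p q : ℝ) : ℂ) = q ^ 2 := by
    rw [z₃]; push_cast; field_simp
  have w := sq_I_mul_sqrt_three
  generalize Complex.I * (√3 : ℝ) = t at *
  have f1 : C ((p : ℂ) ^ 2) * ((X - C (z₁ p q)) * (X - C (z₄ p q)))
      = C ((p : ℂ) ^ 2) * X ^ 2 + C (2 * p * q + (1 + t) / 2) * X + C ((q : ℂ) ^ 2) := by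
    rw [← e2, ← neg_neg (2 * p * q + (1 + t) / 2 : ℂ), ← e1]
    simp only [map_mul, map_neg, map_add]
    ring
  have f2 : C ((p : ℂ) ^ 2) * ((X - C (z₂ p q)) * (X - C (z₅ p q)))
      = C ((p : ℂ) ^ 2) * X ^ 2 + C (2 * p * q + (1 - t) / 2) * X + C ((q : ℂ) ^ 2) := by
    rw [← e4, ← neg_neg (2 * p * q + (1 - t) / 2 : ℂ), ← e3]
    simp only [map_mul, map_neg, map_add]
    ring
  have f3 : C (-(p : ℂ) ^ 2) * (X - C ((z₃ p q : ℝ) : ℂ))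
      = C ((q : ℂ) ^ 2) - C ((p : ℂ) ^ 2) * X := by
    rw [← e5]
    simp only [map_mul, map_neg]
    ring
  have f4 : C (-(p : ℂ) ^ 6) * ((X - C (z₁ p q)) * (X - C (z₂ p q)) * (X - C ((z₃ p q : ℝ) : ℂ))
        * (X - C (z₄ p q)) * (X - C (z₅ p q)))
      = (C (-(p : ℂ) ^ 2) * (X - C ((z₃ p q : ℝ) : ℂ)))
        * ((C ((p : ℂ) ^ 2) * ((X - C (z₁ p q)) * (X - C (z₄ p q))))
        * (C ((p : ℂ) ^ 2) * ((X - C (z₂ p q)) * (X - C (z₅ p q))))) := by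
    simp only [map_neg, map_pow]
    ring
  rw [f4, f1, f2, f3, D]
  simp only [Polynomial.map_mul, Polynomial.map_sub, Polynomial.map_add, Polynomial.map_pow,
    Polynomial.map_C, Polynomial.map_X, Complex.coe_algebraMap]
  -- The middle coefficients of the two conjugate quadratics enter `D` only through their sum and
  -- product, where `t² = -3`.
  have g1 : (2 * p * q + (1 + t) / 2) + (2 * p * q + (1 - t) / 2) = (1 + 4 * p * q : ℂ) := by ring
  have g2 : (2 * p * q + (1 + t) / 2) * (2 * p * q + (1 - t) / 2) + 2 * p ^ 2 * q ^ 2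
      = (1 + 2 * p * q + 6 * p ^ 2 * q ^ 2 : ℂ) := by linear_combination -w / 4
  push_cast
  rw [← g1, ← g2]
  simp only [map_mul, map_add, map_pow, map_ofNat]
  ring

theorem map_D_eq_multiset_prod {p q : ℝ} (hp : 0 < p) (hq : 0 < q) :
    (D p q).map (algebraMap ℝ ℂ) = C (-(p : ℂ) ^ 6)
      * (Multiset.map (fun a => X - C a)
        {z₁ p q, z₂ p q, ((z₃ p q : ℝ) : ℂ), z₄ p q, z₅ p q}).prod := by
  rw [map_D_eq hp hq]
  simp [mul_assoc]

theorem aroots_D {p q : ℝ} (hp : 0 < p) (hq : 0 < q) :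
    (D p q).aroots ℂ = {z₁ p q, z₂ p q, ((z₃ p q : ℝ) : ℂ), z₄ p q, z₅ p q} := by
  have hp' : (p : ℂ) ≠ 0 := Complex.ofReal_ne_zero.2 hp.ne'
  rw [aroots_def, map_D_eq_multiset_prod hp hq, roots_C_mul _ (by simpa using hp'),
    roots_multiset_prod_X_sub_C]

theorem natDegree_D {p q : ℝ} (hp : 0 < p) (hq : 0 < q) :
    (D p q).natDegree = 5 := by
  have hp' : (p : ℂ) ≠ 0 := Complex.ofReal_ne_zero.2 hp.ne'
  rw [← natDegree_map (algebraMap ℝ ℂ), map_D_eq_multiset_prod hp hq,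
    natDegree_C_mul (by simpa using hp'), natDegree_multiset_prod_X_sub_C_eq_card]
  rfl

/-! ### The nested radicals -/

theorem sqrt_mul_sqrt_eq {a W x : ℝ} (ha : 0 ≤ a) (hx : 0 ≤ x) (h : a * W = x ^ 2) :
    √a * √W = x := by
  rw [← Real.sqrt_mul ha, h, Real.sqrt_sq hx]

/-- The real parameters that the zeros of `D` in the unit disk give rise to: `r = (p / q) |z₁|` and
`e = (θ - 1) / 2`. -/
structure IsParam (p q e r : ℝ) : Prop where
  p_pos : 0 < p
  p_lt_q : p < q
  add_eq_one : p + q = 1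
  e_pos : 0 < e
  r_pos : 0 < r
  r_lt_one : r < 1
  theta_eq : θ p q = 2 * e + 1
  e_eq : e ^ 2 + e = p * q + 4 * p ^ 2 * q ^ 2
  r_eq : p * q * (1 + r ^ 2) = (1 + e) * r

namespace IsParam

variable {p q e r : ℝ}

theorem q_pos (H : IsParam p q e r) : 0 < q := H.p_pos.trans H.p_lt_q

theorem p_lt_half (H : IsParam p q e r) : p < 1 / 2 := by
  linarith [H.p_lt_q, H.add_eq_one]

/-- Eliminating `q` leaves two relations in `p`, `e`, `r`. The long coefficients in the
`linear_combination` calls below are the cofactors of these relations, after cancelling a power of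
`p * q` where needed. -/
theorem normal_form (H : IsParam p q e r) : q = 1 - p ∧
    e ^ 2 + e - p * (1 - p) - 4 * (p * (1 - p)) ^ 2 = 0 ∧
    p * (1 - p) * (1 + r ^ 2) - (1 + e) * r = 0 := by
  have hq : q = 1 - p := by linarith [H.add_eq_one]
  have h1 := H.e_eq
  have h2 := H.r_eq
  rw [hq] at h1 h2
  exact ⟨hq, by linear_combination h1, by linear_combination h2⟩

/-- The difference `pq (1 / r - r)`. -/
theorem gap_pos (H : IsParam p q e r) : 0 < 1 + e - 2 * (p * q) * r := by
  have h1 : p * q * r ≤ p * q * 1 :=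
    mul_le_mul_of_nonneg_left H.r_lt_one.le (mul_pos H.p_pos H.q_pos).le
  have h2 := H.add_eq_one
  have h3 := H.e_pos
  nlinarith [sq_nonneg (p - q)]

/-- This denests the radicals: every outer radicand is this square times the square of an expression
in `p` and `e`, up to a constant. -/
theorem gap_sq (H : IsParam p q e r) :
    (1 + e - 2 * (p * q) * r) ^ 2 = 1 + p * q + e := by
  linear_combination 4 * p * q * H.r_eq + H.e_eq

theorem pq_pos (H : IsParam p q e r) : 0 < p * q := mul_pos H.p_pos H.q_pos

theorem val0_eq (H : IsParam p q e r) :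
    q ^ 6 * val0 p q = (q - p) * (q ^ 2 * (q - p) + q * (p + e) * r) := by
  have hgap := H.gap_pos
  have hsq := H.gap_sq
  have hp := H.p_pos
  have he := H.e_pos
  have hq := H.q_pos
  have hs : √2 * √(1 + 28 * p - 60 * p ^ 2 + 40 * p ^ 3 - 8 * p ^ 4
        + (7 - 10 * p + 4 * p ^ 2) * θ p q) = 2 * (p + e) * (1 + e - 2 * (p * q) * r) / p := by
    refine sqrt_mul_sqrt_eq (by norm_num) (by positivity) ?_
    rw [div_pow, mul_pow, hsq, eq_div_iff (by positivity), H.theta_eq, ← sub_eq_zero]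
    obtain ⟨rfl, hE, hR⟩ := H.normal_form
    linear_combination (-4 * e - 12 * p + 4 * p ^ 2) * hE
  have hf : p * (7 - 10 * p + 4 * p ^ 2 + (2 * e + 1)
      - 4 * (q ^ 2 * (q - p) + q * (p + e) * r)) = 2 * (p + e) * (1 + e - 2 * (p * q) * r) := by
    rw [← sub_eq_zero]
    obtain ⟨rfl, hE, hR⟩ := H.normal_form
    linear_combination (-2) * hE
  rw [val0, hs, ← hf, H.theta_eq]
  field_simp
  ring

/-- The factor encodes `π 1 / π 0 = ζ (1 + z₁ + z₂)`. -/
theorem val1_eq (H : IsParam p q e r) :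
    q ^ 2 * val1 p q = (p ^ 2 - e * r) * val0 p q := by
  have hgap := H.gap_pos
  have hsq := H.gap_sq
  have hp := H.p_pos
  have he := H.e_pos
  have hq := H.q_pos
  have hK : 0 < p * (1 - p ^ 2 + 4 * (p * q)) + e * (1 + q ^ 2 + 3 * (p * q) - p ^ 2) := by
    have h1 : 0 < 1 - p ^ 2 := by nlinarith [H.p_lt_half]
    have h2 : 0 < 1 + q ^ 2 + 3 * (p * q) - p ^ 2 := by
      have := H.pq_pos
      nlinarith
    have := H.pq_pos
    positivity
  have hs : √6 * √(-1 + 30 * p + 71 * p ^ 2 - 84 * p ^ 3 - 100 * p ^ 4 + 120 * p ^ 5 - 24 * p ^ 6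
        + (7 + 16 * p - 5 * p ^ 2 - 18 * p ^ 3 + 12 * p ^ 4) * θ p q)
      = 2 * (p * (1 - p ^ 2 + 4 * (p * q)) + e * (1 + q ^ 2 + 3 * (p * q) - p ^ 2))
        * (1 + e - 2 * (p * q) * r) / (p * q) := by
    refine sqrt_mul_sqrt_eq (by norm_num) (by positivity) ?_
    rw [div_pow, mul_pow, hsq, eq_div_iff (by positivity), H.theta_eq, ← sub_eq_zero]
    obtain ⟨rfl, hE, hR⟩ := H.normal_form
    linear_combination (-16 * e - 32 * p - 16 * p * e - 72 * p ^ 2 + 44 * p ^ 2 * e + 132 * p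
      ^ 3 + 24 * p ^ 3 * e + 116 * p ^ 4 - 36 * p ^ 4 * e - 180 * p ^ 5 + 36 * p ^ 6) * hE
  have hf : p * q * (4 * ((q ^ 2 * (q - p) + q * (p + e) * r) * (p ^ 2 - e * r))
        - q * (-3 * (1 + 7 * p - 10 * p ^ 2 + 4 * p ^ 3) - 3 * (1 + p) * (2 * e + 1)))
      = q * (2 * (p * (1 - p ^ 2 + 4 * (p * q)) + e * (1 + q ^ 2 + 3 * (p * q) - p ^ 2))
        * (1 + e - 2 * (p * q) * r)) := by
    refine mul_left_cancel₀ H.pq_pos.ne' ?_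
    rw [← sub_eq_zero]
    obtain ⟨rfl, hE, hR⟩ := H.normal_form
    linear_combination (-4 * p * e ^ 2 - 4 * p ^ 2 * e + 8 * p ^ 2 * e ^ 2 + 8 * p ^ 3 * e - 4
      * p ^ 3 * e ^ 2 - 4 * p ^ 4 * e) * hR + (-4 * p - 4 * p * e * r + 10 * p ^ 2 - 4 * p ^ 2
      * r + 8 * p ^ 2 * e * r - 6 * p ^ 3 + 8 * p ^ 3 * r - 4 * p ^ 3 * e * r - 2 * p ^ 4 - 4
      * p ^ 4 * r + 2 * p ^ 5) * hE
  refine mul_left_cancel₀ (pow_ne_zero 6 hq.ne') ?_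
  rw [mul_left_comm (q ^ 6) (p ^ 2 - e * r), H.val0_eq, val1, hs, H.theta_eq]
  generalize 2 * (p * (1 - p ^ 2 + 4 * (p * q)) + e * (1 + q ^ 2 + 3 * (p * q) - p ^ 2))
    * (1 + e - 2 * (p * q) * r) = k at hf ⊢
  have hk : q * (-3 * (1 + 7 * p - 10 * p ^ 2 + 4 * p ^ 3) - 3 * (1 + p) * (2 * e + 1)
      + k / (p * q)) = 4 * ((q ^ 2 * (q - p) + q * (p + e) * r) * (p ^ 2 - e * r)) := by
    refine mul_left_cancel₀ H.pq_pos.ne' ?_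
    linear_combination -hf + q * mul_div_cancel₀ k H.pq_pos.ne'
  generalize -3 * (1 + 7 * p - 10 * p ^ 2 + 4 * p ^ 3) - 3 * (1 + p) * (2 * e + 1)
    + k / (p * q) = t at hk ⊢
  rw [show q ^ 6 * (q ^ 2 * ((q - p) * t / (4 * q ^ 7))) = (q - p) * (q * t) / 4 by field_simp, hk]
  ring

/-- The factor encodes `π 2 / π 0 = ζ² (1 + h₁ + h₂)`, with `h₁`, `h₂` the complete homogeneous
polynomials in `z₁`, `z₂`. -/
theorem val2_eq (H : IsParam p q e r) :
    q ^ 4 * val2 p q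
      = (p ^ 4 - p ^ 2 * e * r + (e ^ 2 - p ^ 2 * q ^ 2) * r ^ 2) * val0 p q := by
  have hgap := H.gap_pos
  have hsq := H.gap_sq
  have hp := H.p_pos
  have he := H.e_pos
  have hq := H.q_pos
  -- The expression increases in `e`, and `e > p q`; at `e = p q` it equals the polynomial in `h4`.
  have hK : 0 < e - p + 7 * p * e + 9 * p ^ 2 - 2 * p ^ 2 * e + 6 * p ^ 3 - 6 * p ^ 3 * e
      - 14 * p ^ 4 := by
    have h0 := H.p_lt_half
    have h1 : p * q < e := by
      have := H.e_eq
      have := H.pq_pos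
      nlinarith
    have h2 : 0 < 1 + 7 * p - 2 * p ^ 2 - 6 * p ^ 3 := by nlinarith [pow_pos hp 2]
    have h3 := mul_pos (sub_pos.2 h1) h2
    obtain ⟨rfl, -, -⟩ := H.normal_form
    have h4 : 0 < 15 * p ^ 2 - 3 * p ^ 3 - 18 * p ^ 4 + 6 * p ^ 5 + 2 * p ^ 4 - 2 * p ^ 4 := by
      have : 0 < p ^ 2 * (15 - 3 * p - 18 * p ^ 2 + 6 * p ^ 3) := by
        have : 0 < 15 - 3 * p - 18 * p ^ 2 + 6 * p ^ 3 := by nlinarith [pow_pos hp 3]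
        positivity
      linarith
    nlinarith
  have hs : √6 * √(-1 - 16 * p + 64 * p ^ 2 + 656 * p ^ 3 + 52 * p ^ 4 - 1072 * p ^ 5 + 80 * p ^ 6
        + 480 * p ^ 7 - 96 * p ^ 8
        + (1 + 14 * p + 120 * p ^ 2 + 80 * p ^ 3 - 92 * p ^ 4 - 24 * p ^ 5 + 48 * p ^ 6)
          * θ p q)
      = 2 * (e - p + 7 * p * e + 9 * p ^ 2 - 2 * p ^ 2 * e + 6 * p ^ 3 - 6 * p ^ 3 * e - 14 * p ^ 4)
        * (1 + e - 2 * (p * q) * r) / (p * q) := by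
    refine sqrt_mul_sqrt_eq (by norm_num) (by positivity) ?_
    rw [div_pow, mul_pow, hsq, eq_div_iff (by positivity), H.theta_eq, ← sub_eq_zero]
    obtain ⟨rfl, hE, hR⟩ := H.normal_form
    linear_combination (-4 * e + 4 * p - 56 * p * e - 68 * p ^ 2 - 180 * p ^ 2 * e - 692 * p ^
      3 + 160 * p ^ 3 * e + 212 * p ^ 4 + 320 * p ^ 4 * e + 1472 * p ^ 5 - 96 * p ^ 5 * e -
      352 * p ^ 6 - 144 * p ^ 6 * e - 720 * p ^ 7 + 144 * p ^ 8) * hE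
  have hf : p * q * (4 * ((q ^ 2 * (q - p) + q * (p + e) * r)
          * (p ^ 4 - p ^ 2 * e * r + (e ^ 2 - p ^ 2 * q ^ 2) * r ^ 2))
        - q ^ 2 * (3 * (-1 + 6 * p + 14 * p ^ 2 - 20 * p ^ 3 + 8 * p ^ 4)
          + 3 * (1 + 4 * p + 2 * p ^ 2) * (2 * e + 1)))
      = -(q ^ 2 * (2 * (e - p + 7 * p * e + 9 * p ^ 2 - 2 * p ^ 2 * e + 6 * p ^ 3 - 6 * p ^ 3 * e
          - 14 * p ^ 4) * (1 + e - 2 * (p * q) * r))) := by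
    refine mul_left_cancel₀ (pow_ne_zero 2 H.pq_pos.ne') ?_
    rw [← sub_eq_zero]
    obtain ⟨rfl, hE, hR⟩ := H.normal_form
    linear_combination (4 * p * e ^ 3 + 4 * p * e ^ 4 + 8 * p ^ 2 * e ^ 2 - 4 * p ^ 2 * e ^ 3
      + 4 * p ^ 2 * e ^ 3 * r - 8 * p ^ 2 * e ^ 4 - 4 * p ^ 3 * e - 36 * p ^ 3 * e ^ 2 + 4 * p
      ^ 3 * e ^ 2 * r - 4 * p ^ 3 * e ^ 3 - 12 * p ^ 3 * e ^ 3 * r + 4 * p ^ 3 * e ^ 4 - 8 * p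
      ^ 4 + 12 * p ^ 4 * e - 4 * p ^ 4 * e * r + 72 * p ^ 4 * e ^ 2 - 12 * p ^ 4 * e ^ 2 * r +
      4 * p ^ 4 * e ^ 3 + 12 * p ^ 4 * e ^ 3 * r + 48 * p ^ 5 - 4 * p ^ 5 * r - 12 * p ^ 5 * e
      + 20 * p ^ 5 * e * r - 76 * p ^ 5 * e ^ 2 + 12 * p ^ 5 * e ^ 2 * r - 4 * p ^ 5 * e ^ 3 *
      r - 132 * p ^ 6 + 20 * p ^ 6 * r + 4 * p ^ 6 * e - 40 * p ^ 6 * e * r + 40 * p ^ 6 * e ^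
      2 - 4 * p ^ 6 * e ^ 2 * r + 216 * p ^ 7 - 40 * p ^ 7 * r + 40 * p ^ 7 * e * r - 8 * p ^
      7 * e ^ 2 - 224 * p ^ 8 + 40 * p ^ 8 * r - 20 * p ^ 8 * e * r + 144 * p ^ 9 - 20 * p ^ 9
      * r + 4 * p ^ 9 * e * r - 52 * p ^ 10 + 4 * p ^ 10 * r + 8 * p ^ 11) * hR + (4 * p * e ^
      2 * r + 4 * p * e ^ 3 * r + 2 * p ^ 2 + 12 * p ^ 2 * e * r - 4 * p ^ 2 * e ^ 2 - 4 * p ^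
      2 * e ^ 2 * r - 8 * p ^ 2 * e ^ 3 * r - 2 * p ^ 3 + 4 * p ^ 3 * r - 4 * p ^ 3 * e - 36 *
      p ^ 3 * e * r + 12 * p ^ 3 * e ^ 2 - 4 * p ^ 3 * e ^ 2 * r + 4 * p ^ 3 * e ^ 3 * r - 16
      * p ^ 4 - 4 * p ^ 4 * r + 12 * p ^ 4 * e + 36 * p ^ 4 * e * r - 12 * p ^ 4 * e ^ 2 + 4 *
      p ^ 4 * e ^ 2 * r + 40 * p ^ 5 - 24 * p ^ 5 * r - 12 * p ^ 5 * e - 8 * p ^ 5 * e * r + 4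
      * p ^ 5 * e ^ 2 - 30 * p ^ 6 + 56 * p ^ 6 * r + 4 * p ^ 6 * e - 8 * p ^ 6 * e * r - 2 *
      p ^ 7 - 44 * p ^ 7 * r + 4 * p ^ 7 * e * r + 12 * p ^ 8 + 12 * p ^ 8 * r - 4 * p ^ 9) *
      hE
  refine mul_left_cancel₀ (pow_ne_zero 6 hq.ne') ?_
  rw [mul_left_comm (q ^ 6) (p ^ 4 - p ^ 2 * e * r + _), H.val0_eq, val2, hs, H.theta_eq]
  generalize 2 * (e - p + 7 * p * e + 9 * p ^ 2 - 2 * p ^ 2 * e + 6 * p ^ 3 - 6 * p ^ 3 * e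
    - 14 * p ^ 4) * (1 + e - 2 * (p * q) * r) = k at hf ⊢
  have hk : q ^ 2 * (3 * (-1 + 6 * p + 14 * p ^ 2 - 20 * p ^ 3 + 8 * p ^ 4)
      + 3 * (1 + 4 * p + 2 * p ^ 2) * (2 * e + 1) - k / (p * q))
      = 4 * ((q ^ 2 * (q - p) + q * (p + e) * r)
          * (p ^ 4 - p ^ 2 * e * r + (e ^ 2 - p ^ 2 * q ^ 2) * r ^ 2)) := by
    refine mul_left_cancel₀ H.pq_pos.ne' ?_
    linear_combination -hf - q ^ 2 * mul_div_cancel₀ k H.pq_pos.ne'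
  generalize 3 * (-1 + 6 * p + 14 * p ^ 2 - 20 * p ^ 3 + 8 * p ^ 4)
    + 3 * (1 + 4 * p + 2 * p ^ 2) * (2 * e + 1) - k / (p * q) = t at hk ⊢
  rw [show q ^ 6 * (q ^ 4 * ((q - p) * t / (4 * q ^ 8))) = (q - p) * (q ^ 2 * t) / 4 by field_simp,
    hk]
  ring

theorem amp_eq (H : IsParam p q e r) :
    3 * q ^ 6 * amp p q
      = (q - p) * (p * (p + e) + (q - p) * (1 + e - p * q * r)) ^ 2 := by
  have hgap := H.gap_pos
  have hsq := H.gap_sq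
  have hp := H.p_pos
  have he := H.e_pos
  have hq := H.q_pos
  have hs : √2 * √(v p + u p * θ p q)
      = 2 * (2 * p ^ 2 + q - p + e) * (1 + e - 2 * (p * q) * r) := by
    have : 0 < 2 * p ^ 2 + q - p + e := by nlinarith [H.p_lt_q]
    refine sqrt_mul_sqrt_eq (by norm_num) (by positivity) ?_
    rw [mul_pow, hsq, H.theta_eq, u, v, ← sub_eq_zero]
    obtain ⟨rfl, hE, hR⟩ := H.normal_form
    linear_combination (-8 - 4 * e + 12 * p - 12 * p ^ 2) * hE
  have hf : 4 * (p * (p + e) + (q - p) * (1 + e - p * q * r)) ^ 2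
      = u p + (q - p) ^ 2 * (2 * e + 1)
        + (q - p) * (2 * (2 * p ^ 2 + q - p + e) * (1 + e - 2 * (p * q) * r)) := by
    refine mul_left_cancel₀ H.pq_pos.ne' ?_
    rw [← sub_eq_zero, u]
    obtain ⟨rfl, hE, hR⟩ := H.normal_form
    linear_combination (4 * p ^ 2 - 24 * p ^ 3 + 52 * p ^ 4 - 48 * p ^ 5 + 16 * p ^ 6) * hR +
      (2 * p - 6 * p ^ 2 + 8 * p ^ 3 - 4 * p ^ 4) * hE
  rw [amp, mul_right_comm (√2), hs, H.theta_eq]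
  generalize 2 * (2 * p ^ 2 + q - p + e) * (1 + e - 2 * (p * q) * r) = k at hf ⊢
  rw [mul_div_assoc', mul_comm (12 : ℝ), mul_assoc 3, mul_comm 3, mul_assoc (q ^ 6),
    mul_div_mul_left _ _ (pow_ne_zero 6 hq.ne')]
  linear_combination -(q - p) / 4 * hf

/-- The weight `p² + e r + q² r²` is `p² (1 - z₁)(1 - z₂)`; this is `num(0) = κ z₁ z₂` with `κ`
fixed by `num(1) = 3 (q - p)`. -/
theorem val0_mul (H : IsParam p q e r) :
    q ^ 6 * val0 p q * (p ^ 2 + e * r + q ^ 2 * r ^ 2) = 3 * (q - p) * q ^ 2 * r ^ 2 := by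
  have hf : (q ^ 2 * (q - p) + q * (p + e) * r) * (p ^ 2 + e * r + q ^ 2 * r ^ 2)
      = 3 * q ^ 2 * r ^ 2 := by
    refine mul_left_cancel₀ (pow_ne_zero 2 H.pq_pos.ne') ?_
    rw [← sub_eq_zero]
    obtain ⟨rfl, hE, hR⟩ := H.normal_form
    linear_combination (e + e ^ 2 - p - 2 * p * e + p * e * r - 2 * p * e ^ 2 - p ^ 2 + p ^ 2
      * r + p ^ 2 * e - 4 * p ^ 2 * e * r + p ^ 2 * e ^ 2 + 14 * p ^ 3 - 4 * p ^ 3 * r + 6 * p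
      ^ 3 * e * r - 28 * p ^ 4 + 6 * p ^ 4 * r - 4 * p ^ 4 * e * r + 25 * p ^ 5 - 4 * p ^ 5 *
      r + p ^ 5 * e * r - 11 * p ^ 6 + p ^ 6 * r + 2 * p ^ 7) * hR + (r + e * r - p - 2 * p *
      r - 2 * p * e * r + 3 * p ^ 2 + p ^ 2 * r + p ^ 2 * e * r - 3 * p ^ 3 + p ^ 4) * hE
  rw [H.val0_eq]
  linear_combination (q - p) * hf

theorem amp_aux (H : IsParam p q e r) :
    (p * (p + e) + (q - p) * (1 + e - p * q * r)) * r * q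
      = (q ^ 2 * (q - p) + q * (p + e) * r) * p := by
  refine mul_left_cancel₀ H.pq_pos.ne' ?_
  rw [← sub_eq_zero]
  obtain ⟨rfl, hE, hR⟩ := H.normal_form
  linear_combination (-p + 4 * p ^ 2 - 5 * p ^ 3 + 2 * p ^ 4) * hR

theorem weight_pos (H : IsParam p q e r) : 0 < p ^ 2 + e * r + q ^ 2 * r ^ 2 := by
  have := H.p_pos
  have := H.e_pos
  have := H.r_pos
  positivity

/-- In terms of the roots: the amplitude is `π 0 / ((1 - z₁)(1 - z₂))`. -/
theorem amp_mul (H : IsParam p q e r) :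
    amp p q * (p ^ 2 + e * r + q ^ 2 * r ^ 2) = p ^ 2 * val0 p q := by
  have hr := H.r_pos.ne'
  have hq := H.q_pos.ne'
  have h1 := H.amp_eq
  have h2 := H.amp_aux
  have h3 := H.val0_mul
  have h4 := H.val0_eq
  set w := p ^ 2 + e * r + q ^ 2 * r ^ 2
  set Y := q ^ 2 * (q - p) + q * (p + e) * r
  set Z := p * (p + e) + (q - p) * (1 + e - p * q * r)
  have h5 : 0 < q - p := sub_pos.2 H.p_lt_q
  have h6 : Y * w = 3 * q ^ 2 * r ^ 2 := by
    refine mul_left_cancel₀ h5.ne' ?_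
    linear_combination h3 - w * h4
  have h7 : 3 * q ^ 6 * (q ^ 2 * r ^ 2) ≠ 0 := by positivity
  refine mul_left_cancel₀ h7 ?_
  linear_combination (q ^ 2 * r ^ 2 * w) * h1 + (q - p) * w * (Z * r * q + Y * p) * h2
    + (q - p) * Y * p ^ 2 * h6 - 3 * q ^ 2 * r ^ 2 * p ^ 2 * h4

theorem val0_eq' (H : IsParam p q e r) :
    q ^ 4 * val0 p q = (q - p) * (q ^ 2 + e * r + p ^ 2 * r ^ 2) := by
  have hf : q ^ 2 * (q - p) + q * (p + e) * r = q ^ 2 * (q ^ 2 + e * r + p ^ 2 * r ^ 2) := by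
    refine mul_left_cancel₀ H.pq_pos.ne' ?_
    rw [← sub_eq_zero]
    obtain ⟨rfl, hE, hR⟩ := H.normal_form
    linear_combination (-p ^ 2 + 2 * p ^ 3 - p ^ 4) * hR
  refine mul_left_cancel₀ (pow_ne_zero 2 H.q_pos.ne') ?_
  linear_combination H.val0_eq + (q - p) * hf

/-- The coefficients of a numerator proportional to the quadratic polynomial with zeros `z₁`, `z₂`
determine its parameters. -/
theorem eq_val (H : IsParam p q e r) {x₀ x₁ x₂ κ : ℝ}
    (h0 : p ^ 2 * (q ^ 6 * x₀) = κ * (q ^ 2 * r ^ 2))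
    (h1 : p ^ 2 * (q ^ 6 * x₀ + (q ^ 6 * x₁ + 6 * p * q ^ 5 * x₀)) = κ * (e * r))
    (h2 : q ^ 6 * x₀ + (q ^ 6 * x₁ + 6 * p * q ^ 5 * x₀)
      + (q ^ 6 * x₂ + 6 * p * q ^ 5 * x₁ + 15 * p ^ 2 * q ^ 4 * x₀) = κ)
    (h3 : κ * (p ^ 2 + e * r + q ^ 2 * r ^ 2) = 3 * (q - p) * p ^ 2) :
    x₀ = val0 p q ∧ x₁ = val1 p q ∧ x₂ = val2 p q := by
  have hp := H.p_pos.ne'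
  have hq := H.q_pos.ne'
  have hr := H.r_pos.ne'
  have k2 : e * (1 + r ^ 2) = (1 + 4 * (p * q)) * r := by
    refine mul_left_cancel₀ H.pq_pos.ne' ?_
    rw [← sub_eq_zero]
    obtain ⟨rfl, hE, hR⟩ := H.normal_form
    linear_combination (e) * hR + (r) * hE
  have k3 : q ^ 2 * (p ^ 2 - e * r) - 6 * (p * q) * r ^ 2 * (p ^ 2 - e * r)
      - 15 * (p * q) ^ 2 * r ^ 2
      = r ^ 2 * (p ^ 4 - p ^ 2 * e * r + (e ^ 2 - (p * q) ^ 2) * r ^ 2) := by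
    refine mul_left_cancel₀ (pow_ne_zero 3 H.pq_pos.ne') ?_
    rw [← sub_eq_zero]
    obtain ⟨rfl, hE, hR⟩ := H.normal_form
    linear_combination (-e ^ 2 - 2 * e ^ 3 - e ^ 4 - p * e ^ 2 * r - p * e ^ 3 * r + p ^ 2 + 8
      * p ^ 2 * e + 8 * p ^ 2 * e ^ 2 + p ^ 2 * e ^ 2 * r - p ^ 2 * e ^ 2 * r ^ 2 + p ^ 2 * e
      ^ 3 * r - 2 * p ^ 3 + p ^ 3 * r - 15 * p ^ 3 * e + 7 * p ^ 3 * e * r - 15 * p ^ 3 * e ^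
      2 + 2 * p ^ 3 * e ^ 2 * r ^ 2 - 15 * p ^ 4 - 3 * p ^ 4 * r + p ^ 4 * r ^ 2 + 7 * p ^ 4 *
      e - 20 * p ^ 4 * e * r + 7 * p ^ 4 * e ^ 2 - p ^ 4 * e ^ 2 * r ^ 2 + 58 * p ^ 5 + 3 * p
      ^ 5 * r - 4 * p ^ 5 * r ^ 2 + 19 * p ^ 5 * e * r - 79 * p ^ 6 - p ^ 6 * r + 6 * p ^ 6 *
      r ^ 2 - 6 * p ^ 6 * e * r + 48 * p ^ 7 - 4 * p ^ 7 * r ^ 2 - 11 * p ^ 8 + p ^ 8 * r ^ 2)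
      * hR + (-e * r - 2 * e ^ 2 * r - e ^ 3 * r - p * r + p * e - p * e * r + p * e ^ 2 + p ^
      2 + 5 * p ^ 2 * r - p ^ 2 * e + 6 * p ^ 2 * e * r - p ^ 2 * e ^ 2 - 6 * p ^ 3 - 7 * p ^
      3 * r - 9 * p ^ 3 * e * r + 12 * p ^ 4 + 3 * p ^ 4 * r + 4 * p ^ 4 * e * r - 10 * p ^ 5
      + 3 * p ^ 6) * hE
  have e0 : x₀ = val0 p q := by
    refine mul_left_cancel₀ (pow_ne_zero 6 hq) (mul_right_cancel₀ H.weight_pos.ne' ?_)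
    rw [H.val0_mul]
    refine mul_left_cancel₀ (pow_ne_zero 2 hp) ?_
    linear_combination (p ^ 2 + e * r + q ^ 2 * r ^ 2) * h0 + q ^ 2 * r ^ 2 * h3
  have e1 : q ^ 2 * x₁ = (p ^ 2 - e * r) * x₀ := by
    have : p ^ 2 * q ^ 6 * r ≠ 0 := by positivity
    refine mul_left_cancel₀ this ?_
    linear_combination q ^ 2 * r * h1 - e * h0 + p ^ 2 * q ^ 6 * x₀ * k2
      - p ^ 2 * q ^ 6 * x₀ * r * (p + q + 1) * H.add_eq_one
  have e1' : q ^ 2 * r * (q ^ 6 * x₀ + (q ^ 6 * x₁ + 6 * p * q ^ 5 * x₀)) = e * (q ^ 6 * x₀) := by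
    refine mul_left_cancel₀ (pow_ne_zero 2 hp) ?_
    linear_combination q ^ 2 * r * h1 - e * h0
  have e2 : q ^ 4 * x₂ = (p ^ 4 - p ^ 2 * e * r + (e ^ 2 - p ^ 2 * q ^ 2) * r ^ 2) * x₀ := by
    have : q ^ 4 * r ^ 2 ≠ 0 := by positivity
    refine mul_left_cancel₀ this ?_
    linear_combination q ^ 2 * r ^ 2 * h2 - h0 - r * e1' - 6 * p * q ^ 5 * r ^ 2 * e1
      + q ^ 4 * x₀ * k3
  subst e0
  refine ⟨rfl, ?_, ?_⟩
  · refine mul_left_cancel₀ (pow_ne_zero 2 hq) ?_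
    rw [e1, H.val1_eq]
  · refine mul_left_cancel₀ (pow_ne_zero 4 hq) ?_
    rw [e2, H.val2_eq]

end IsParam

/-- Two real consequences of the quadratic for `z₁` involve only its real part and norm; eliminating
the real part leaves a quadratic for `pq (1 + r²) / r` with roots `1 + e` and `-e`. -/
theorem isParam_z₁ {p q : ℝ} (hp : 0 < p) (hpq : p < q) (hsum : p + q = 1) :
    IsParam p q ((θ p q - 1) / 2) (p / q * ‖z₁ p q‖) ∧
      p ^ 2 * (2 * (z₁ p q).re) = -((θ p q - 1) / 2 * (p / q * ‖z₁ p q‖)) := by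
  have hq : 0 < q := hp.trans hpq
  have hpq0 : 0 < p * q := mul_pos hp hq
  have hquad := z₁_quadratic q hp.ne'
  have him := im_ne_zero_of_quadratic hq.ne' hquad
  have hnorm := normSq_add_mul_of_quadratic hquad
  have hlt := norm_z₁_lt_one hp hpq hsum
  have hsq : ‖z₁ p q‖ ^ 2 = (z₁ p q).re * (z₁ p q).re + (z₁ p q).im * (z₁ p q).im := by
    rw [← Complex.normSq_eq_norm_sq, Complex.normSq_apply]
  have hpos : 0 < ‖z₁ p q‖ := norm_pos_iff.2 fun h => him (by rw [h, Complex.zero_im])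
  have hre := congrArg Complex.re hquad
  have hi := congrArg Complex.im hquad
  rw [Complex.normSq_apply] at hnorm
  simp [sq] at hnorm hre hi
  set x := (z₁ p q).re
  set y := (z₁ p q).im
  set R := ‖z₁ p q‖
  obtain ⟨r, hr⟩ : ∃ r, r = p / q * R := ⟨_, rfl⟩
  have hR : p * R = q * r := by rw [hr]; field_simp
  obtain ⟨e, he⟩ : ∃ e, e = (θ p q - 1) / 2 := ⟨_, rfl⟩
  rw [← hr, ← he]
  have hr0 : 0 < r := by rw [hr]; positivity
  have hr1 : r < 1 := by
    have : q * r < q * 1 := by rw [← hR]; nlinarith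
    exact lt_of_mul_lt_mul_left this hq.le
  have hθ0 : 0 ≤ θ p q := Real.sqrt_nonneg _
  have hθ : θ p q ^ 2 = 1 + 4 * p * q + 16 * p ^ 2 * q ^ 2 := Real.sq_sqrt (by positivity)
  have he2 : e ^ 2 + e = p * q + 4 * p ^ 2 * q ^ 2 := by
    rw [he]; linear_combination hθ / 4
  have he0 : 0 < e := by
    have : 0 < (p * q) ^ 2 := by positivity
    rw [he]; nlinarith
  -- This is `|q + p z₁|² = |z₁|`.
  have h1 : p * q * (1 + r ^ 2) + p ^ 2 * (2 * x) = r := by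
    refine mul_left_cancel₀ hq.ne' ?_
    linear_combination p * hnorm - (p * q * r + p ^ 2 * R) * hR + hR + p ^ 3 * hsq
  -- Real part of the quadratic multiplied by the conjugate of `z₁`.
  have h2 : (1 + r ^ 2) * (p ^ 2 * (2 * x)) + (1 + 4 * (p * q)) * r ^ 2 = 0 := by
    refine mul_left_cancel₀ (pow_ne_zero 2 hq.ne') ?_
    linear_combination 2 * p ^ 2 * (x * hre + y * hi) + 2 * p ^ 4 * x * hsq
      - 2 * p ^ 2 * x * (q * r + p * R) * hR
      + (1 + 4 * (p * q)) * p ^ 2 * hsq - (1 + 4 * (p * q)) * (q * r + p * R) * hR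
  have h3 : (p * q * (1 + r ^ 2) - (1 + e) * r) * (p * q * (1 + r ^ 2) + e * r) = 0 := by
    linear_combination -r ^ 2 * he2 + p * q * (1 + r ^ 2) * h1 - p * q * h2
  have h4 : 0 < p * q * (1 + r ^ 2) + e * r := by positivity
  have h5 : p * q * (1 + r ^ 2) = (1 + e) * r := by
    rcases mul_eq_zero.1 h3 with h | h
    · linarith
    · exact absurd h h4.ne'
  exact ⟨⟨hp, hpq, hsum, he0, hr0, hr1, by rw [he]; ring, he2, h5⟩, by linear_combination h1 - h5⟩

/-! ### Numerators vanishing at `z₁` and the normalization -/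

theorem coeff_eq_of_root {z : ℂ} (hz : z.im ≠ 0) {c₀ c₁ c₂ : ℝ}
    (h : (c₀ : ℂ) + c₁ * z + c₂ * z ^ 2 = 0) :
    c₁ = -c₂ * (2 * z.re) ∧ c₀ = c₂ * ‖z‖ ^ 2 := by
  have hre := congrArg Complex.re h
  have him := congrArg Complex.im h
  simp [sq] at hre him
  have h1 : c₁ = -c₂ * (2 * z.re) := by
    refine mul_right_cancel₀ hz ?_
    linear_combination him
  refine ⟨h1, ?_⟩
  rw [← Complex.normSq_eq_norm_sq, Complex.normSq_apply]
  linear_combination hre - z.re * h1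

theorem aeval_num (p q x₀ x₁ x₂ : ℝ) (z : ℂ) : aeval z (num p q x₀ x₁ x₂)
    = ((q ^ 6 * x₀ : ℝ) : ℂ) + ((q ^ 6 * x₀ + (q ^ 6 * x₁ + 6 * p * q ^ 5 * x₀) : ℝ) : ℂ) * z
      + ((q ^ 6 * x₀ + (q ^ 6 * x₁ + 6 * p * q ^ 5 * x₀)
        + (q ^ 6 * x₂ + 6 * p * q ^ 5 * x₁ + 15 * p ^ 2 * q ^ 4 * x₀) : ℝ) : ℂ) * z ^ 2 := by
  simp only [num, aeval_add, aeval_mul, aeval_C, aeval_X, aeval_X_pow, Complex.coe_algebraMap]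

theorem aeval_N {p q : ℝ} (hsum : p + q = 1) (x₀ x₁ x₂ : ℝ) (z : ℂ) :
    aeval z (N p x₀ x₁ x₂)
      = aeval z (num p q x₀ x₁ x₂) - aeval z (D p q) * (x₀ + x₁ * z + x₂ * z ^ 2) := by
  rw [N_eq hsum]
  simp only [aeval_sub, aeval_add, aeval_mul, aeval_C, aeval_X, aeval_X_pow,
    Complex.coe_algebraMap]

theorem aeval_D_z₁ {p q : ℝ} (hp : 0 < p) (hq : 0 < q) : aeval (z₁ p q) (D p q) = 0 := by
  refine (mem_aroots'.1 (?_ : z₁ p q ∈ (D p q).aroots ℂ)).2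
  rw [aroots_D hp hq]
  simp

theorem aeval_D_z₂ {p q : ℝ} (hp : 0 < p) (hq : 0 < q) : aeval (z₂ p q) (D p q) = 0 := by
  refine (mem_aroots'.1 (?_ : z₂ p q ∈ (D p q).aroots ℂ)).2
  rw [aroots_D hp hq]
  simp

/-- The right side is `num(1) = D(1)`; `L` is what remains after dividing by `D(1) = 3 (q - p)`. -/
theorem normalization_iff {p q : ℝ} (hpq : p < q) (hsum : p + q = 1) (x₀ x₁ x₂ : ℝ) :
    x₀ + x₁ + x₂ + L p q x₀ x₁ x₂ = 1 ↔
      q ^ 6 * x₀ + (q ^ 6 * x₀ + (q ^ 6 * x₁ + 6 * p * q ^ 5 * x₀))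
        + (q ^ 6 * x₀ + (q ^ 6 * x₁ + 6 * p * q ^ 5 * x₀)
          + (q ^ 6 * x₂ + 6 * p * q ^ 5 * x₁ + 15 * p ^ 2 * q ^ 4 * x₀)) = 3 * (q - p) := by
  have h : 3 * (q - p) ≠ 0 := by
    have := sub_pos.2 hpq
    positivity
  have e : 3 * (q - p) * (x₀ + x₁ + x₂ + L p q x₀ x₁ x₂)
      = q ^ 6 * x₀ + (q ^ 6 * x₀ + (q ^ 6 * x₁ + 6 * p * q ^ 5 * x₀))
        + (q ^ 6 * x₀ + (q ^ 6 * x₁ + 6 * p * q ^ 5 * x₀)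
          + (q ^ 6 * x₂ + 6 * p * q ^ 5 * x₁ + 15 * p ^ 2 * q ^ 4 * x₀)) := by
    rw [L, mul_add, mul_div_cancel₀ _ h]
    obtain rfl : q = 1 - p := by linarith
    ring
  rw [← e]
  constructor
  · intro h1; rw [h1, mul_one]
  · intro h1; exact mul_left_cancel₀ h (by rw [h1, mul_one])

/-- A numerator that vanishes at `z₁` is a multiple of the quadratic polynomial with zeros `z₁`,
`z₂`. -/
theorem num_coeff_of_aeval_eq_zero {p q : ℝ} (hp : 0 < p) (hpq : p < q)
    {x₀ x₁ x₂ : ℝ} (h : aeval (z₁ p q) (num p q x₀ x₁ x₂) = 0) :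
    ∃ κ, q ^ 6 * x₀ + (q ^ 6 * x₁ + 6 * p * q ^ 5 * x₀)
        + (q ^ 6 * x₂ + 6 * p * q ^ 5 * x₁ + 15 * p ^ 2 * q ^ 4 * x₀) = κ ∧
      q ^ 6 * x₀ + (q ^ 6 * x₁ + 6 * p * q ^ 5 * x₀) = -κ * (2 * (z₁ p q).re) ∧
      q ^ 6 * x₀ = κ * ‖z₁ p q‖ ^ 2 := by
  have hq : 0 < q := hp.trans hpq
  rw [aeval_num] at h
  exact ⟨_, rfl, coeff_eq_of_root (im_ne_zero_of_quadratic hq.ne' (z₁_quadratic q hp.ne')) h⟩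

theorem eq_val_of_aeval_num {p q : ℝ} (hp : 0 < p) (hpq : p < q) (hsum : p + q = 1)
    {x₀ x₁ x₂ : ℝ} (h : aeval (z₁ p q) (num p q x₀ x₁ x₂) = 0)
    (hL : x₀ + x₁ + x₂ + L p q x₀ x₁ x₂ = 1) :
    x₀ = val0 p q ∧ x₁ = val1 p q ∧ x₂ = val2 p q := by
  have hq : 0 < q := hp.trans hpq
  obtain ⟨H, hre⟩ := isParam_z₁ hp hpq hsum
  obtain ⟨κ, h2, h1, h0⟩ := num_coeff_of_aeval_eq_zero hp hpq h
  have h3 := (normalization_iff hpq hsum x₀ x₁ x₂).1 hL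
  have hr : q * (p / q * ‖z₁ p q‖) = p * ‖z₁ p q‖ := by field_simp
  generalize p / q * ‖z₁ p q‖ = r at *
  generalize (θ p q - 1) / 2 = e at *
  have k0 : p ^ 2 * (q ^ 6 * x₀) = κ * (q ^ 2 * r ^ 2) := by
    linear_combination p ^ 2 * h0 - κ * (q * r + p * ‖z₁ p q‖) * hr
  have k1 : p ^ 2 * (q ^ 6 * x₀ + (q ^ 6 * x₁ + 6 * p * q ^ 5 * x₀)) = κ * (e * r) := by
    linear_combination p ^ 2 * h1 - κ * hre
  refine H.eq_val k0 k1 h2 ?_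
  linear_combination p ^ 2 * h3 - k0 - k1 - p ^ 2 * h2

/-! ### Stationary distributions -/

section Stationary

variable {p q : ℝ} {π : ℕ → ℝ}

theorem hasSum_mul_pow (h : IsStationary (P p q) π) {z : ℂ} (hz : ‖z‖ ≤ 1) :
    HasSum (fun j => (π j : ℂ) * z ^ j) (∑' j, (π j : ℂ) * z ^ j) := by
  refine (Summable.of_norm_bounded h.hasSum_one.summable fun j => ?_).hasSum
  rw [norm_mul, norm_pow, Complex.norm_real, Real.norm_of_nonneg (h.nonneg j)]
  exact mul_le_of_le_one_right (h.nonneg j) (pow_le_one₀ (norm_nonneg _) hz)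

theorem aeval_D_mul_tsum (hsum : p + q = 1) (h : IsStationary (P p q) π) {z : ℂ}
    (hz : ‖z‖ ≤ 1) :
    aeval z (D p q) * ∑' j, (π j : ℂ) * z ^ j = aeval z (num p q (π 0) (π 1) (π 2)) :=
  aeval_eq_of_mk_mul_eq (hasSum_mul_pow h hz) (D_mul_mk_eq_num hsum h.invariant)

theorem aeval_D_one (hsum : p + q = 1) : aeval (1 : ℂ) (D p q) = ((3 * (q - p) : ℝ) : ℂ) := by
  obtain rfl : q = 1 - p := by linarith
  simp only [D, aeval_add, aeval_sub, aeval_mul, aeval_C, aeval_X, aeval_X_pow,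
    Complex.coe_algebraMap]
  push_cast
  ring

theorem normalization (hpq : p < q) (hsum : p + q = 1) (h : IsStationary (P p q) π) :
    π 0 + π 1 + π 2 + L p q (π 0) (π 1) (π 2) = 1 := by
  rw [normalization_iff hpq hsum]
  have h1 := aeval_D_mul_tsum hsum h (z := 1) (by simp)
  simp only [one_pow, mul_one] at h1
  rw [← Complex.ofReal_tsum, h.hasSum_one.tsum_eq, aeval_D_one hsum, aeval_num] at h1
  rw [Complex.ofReal_one, mul_one, mul_one, one_pow, mul_one, ← Complex.ofReal_add,
    ← Complex.ofReal_add] at h1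
  exact (Complex.ofReal_injective h1).symm

theorem aeval_num_z₁ (hp : 0 < p) (hpq : p < q) (hsum : p + q = 1)
    (h : IsStationary (P p q) π) : aeval (z₁ p q) (num p q (π 0) (π 1) (π 2)) = 0 := by
  rw [← aeval_D_mul_tsum hsum h (norm_z₁_lt_one hp hpq hsum).le, aeval_D_z₁ hp (hp.trans hpq),
    zero_mul]

theorem aeval_num_z₂ (hp : 0 < p) (hpq : p < q) (hsum : p + q = 1)
    (h : IsStationary (P p q) π) : aeval (z₂ p q) (num p q (π 0) (π 1) (π 2)) = 0 := by
  have hq := hp.trans hpq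
  have hz : ‖z₂ p q‖ ≤ 1 := by
    rw [z₂_eq_conj hp hq, Complex.norm_conj]
    exact (norm_z₁_lt_one hp hpq hsum).le
  rw [← aeval_D_mul_tsum hsum h hz, aeval_D_z₂ hp hq, zero_mul]

theorem IsStationary.eq_val (hp : 0 < p) (hpq : p < q) (hsum : p + q = 1)
    (h : IsStationary (P p q) π) : π 0 = val0 p q ∧ π 1 = val1 p q ∧ π 2 = val2 p q :=
  eq_val_of_aeval_num hp hpq hsum (aeval_num_z₁ hp hpq hsum h) (normalization hpq hsum h)

/-- Equal initial values give equal numerators, and `D` cancels in the domain of power series. -/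
theorem IsStationary.unique (hp : 0 < p) (hpq : p < q) (hsum : p + q = 1) {π' : ℕ → ℝ}
    (h : IsStationary (P p q) π) (h' : IsStationary (P p q) π') : π = π' := by
  obtain ⟨e0, e1, e2⟩ := h.eq_val hp hpq hsum
  obtain ⟨f0, f1, f2⟩ := h'.eq_val hp hpq hsum
  have hD : (D p q : PowerSeries ℝ) ≠ 0 := by
    rw [Ne, coe_eq_zero_iff]
    intro h0
    have := natDegree_D hp (hp.trans hpq)
    rw [h0, natDegree_zero] at this
    omega
  have h1 : PowerSeries.mk π = PowerSeries.mk π' := by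
    refine mul_left_cancel₀ hD ?_
    rw [D_mul_mk_eq_num hsum h.invariant, D_mul_mk_eq_num hsum h'.invariant, e0, e1, e2, f0, f1, f2]
  funext j
  simpa using congrArg (PowerSeries.coeff j) h1

theorem hasSum_tail (hsum : p + q = 1) (h : IsStationary (P p q) π) {z : ℂ}
    (hz : ‖z‖ ≤ 1) (hD : aeval z (D p q) ≠ 0) :
    HasSum (fun j : ℕ => (π (j + 3) : ℂ) * z ^ (j + 3))
      (aeval z (N p (π 0) (π 1) (π 2)) / aeval z (D p q)) := by
  have h1 := (hasSum_nat_add_iff' 3).2 (hasSum_mul_pow h hz)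
  have h2 : aeval z (N p (π 0) (π 1) (π 2)) / aeval z (D p q)
      = (∑' j, (π j : ℂ) * z ^ j) - ∑ i ∈ Finset.range 3, (π i : ℂ) * z ^ i := by
    rw [aeval_N hsum, ← aeval_D_mul_tsum hsum h hz, ← mul_sub, mul_div_cancel_left₀ _ hD]
    simp [Finset.sum_range_succ]
  rwa [h2]

theorem tendsto_tail (hpq : p < q) (hsum : p + q = 1) (h : IsStationary (P p q) π) :
    Filter.Tendsto (fun x : ℝ => ∑' j : ℕ, π (j + 3) * x ^ (j + 3))
      (nhdsWithin 1 (Set.Iio 1)) (nhds (L p q (π 0) (π 1) (π 2))) := by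
  have h1 := (hasSum_nat_add_iff' 3).2 h.hasSum_one
  have h2 : (1 : ℝ) - ∑ i ∈ Finset.range 3, π i = L p q (π 0) (π 1) (π 2) := by
    simp only [Finset.sum_range_succ, Finset.sum_range_zero]
    linear_combination -normalization hpq hsum h
  rw [h2] at h1
  have h3 := Real.tendsto_tsum_powerSeries_nhdsWithin_lt h1.tendsto_sum_nat
  have h4 : Filter.Tendsto (fun x : ℝ => x ^ 3) (nhdsWithin 1 (Set.Iio 1)) (nhds (1 ^ 3)) :=
    ((continuous_pow 3).tendsto 1).mono_left nhdsWithin_le_nhds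
  have h5 := h4.mul h3
  rw [one_pow, one_mul] at h5
  refine h5.congr fun x => ?_
  rw [← tsum_mul_left]
  exact tsum_congr fun j => by ring

/-! ### The asymptotics of the stationary distribution -/

theorem residue_eq_amp (hp : 0 < p) (hpq : p < q) (hsum : p + q = 1)
    (h : IsStationary (P p q) π) :
    -(N p (π 0) (π 1) (π 2)).eval (z₃ p q) / (z₃ p q * (derivative (D p q)).eval (z₃ p q))
      = amp p q := by
  have hq := hp.trans hpq
  obtain ⟨H, hre⟩ := isParam_z₁ hp hpq hsum
  obtain ⟨κ, h2, h1, h0⟩ := num_coeff_of_aeval_eq_zero hp hpq (aeval_num_z₁ hp hpq hsum h)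
  have h3 := (normalization_iff hpq hsum _ _ _).1 (normalization hpq hsum h)
  have hv := (h.eq_val hp hpq hsum).1
  have hr : q * (p / q * ‖z₁ p q‖) = p * ‖z₁ p q‖ := by field_simp
  have hz : p ^ 2 * z₃ p q = q ^ 2 := by rw [z₃]; field_simp
  -- Only the derivative of the vanishing factor `q² - p² z` survives at `z₃`.
  have hD : (derivative (D p q)).eval (z₃ p q) = -3 * q ^ 4 / p ^ 2 := by
    simp only [D, derivative_mul, derivative_sub, derivative_C, derivative_X, eval_add, eval_mul,
      eval_sub, eval_C, eval_X, eval_pow, mul_one, zero_mul, zero_sub, zero_add, eval_neg,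
      hz, sub_self, add_zero]
    rw [z₃]
    obtain rfl : q = 1 - p := by linarith
    field_simp
    ring
  have hN : (N p (π 0) (π 1) (π 2)).eval (z₃ p q)
      = q ^ 6 * π 0 + (q ^ 6 * π 0 + (q ^ 6 * π 1 + 6 * p * q ^ 5 * π 0)) * z₃ p q
        + κ * z₃ p q ^ 2 := by
    rw [N_eq hsum, ← h2]
    simp only [D, num, eval_add, eval_mul, eval_sub, eval_C, eval_X, eval_pow, hz, sub_self,
      zero_mul, sub_zero]
  generalize p / q * ‖z₁ p q‖ = r at *
  generalize (θ p q - 1) / 2 = e at *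
  have k0 : p ^ 2 * (q ^ 6 * π 0) = κ * (q ^ 2 * r ^ 2) := by
    linear_combination p ^ 2 * h0 - κ * (q * r + p * ‖z₁ p q‖) * hr
  have k1 : p ^ 2 * (q ^ 6 * π 0 + (q ^ 6 * π 1 + 6 * p * q ^ 5 * π 0)) = κ * (e * r) := by
    linear_combination p ^ 2 * h1 - κ * hre
  have k2 : κ * (p ^ 2 + e * r + q ^ 2 * r ^ 2) = 3 * (q - p) * p ^ 2 := by
    linear_combination p ^ 2 * h3 - k0 - k1 - p ^ 2 * h2
  have k3 := H.amp_mul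
  have k4 := H.val0_eq'
  rw [← hv] at k3 k4
  have k5 : p ^ 4 * (N p (π 0) (π 1) (π 2)).eval (z₃ p q)
      = κ * q ^ 2 * (q ^ 2 + e * r + p ^ 2 * r ^ 2) := by
    rw [hN]
    linear_combination p ^ 2 * k0 + q ^ 2 * k1
      + p ^ 2 * (q ^ 6 * π 0 + (q ^ 6 * π 1 + 6 * p * q ^ 5 * π 0)) * hz
      + κ * (p ^ 2 * z₃ p q + q ^ 2) * hz
  have k6 : amp p q = κ * (q ^ 2 + e * r + p ^ 2 * r ^ 2) / (3 * q ^ 4) := by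
    have hd := sub_pos.2 hpq
    rw [eq_div_iff (by positivity)]
    refine mul_right_cancel₀ (mul_pos hd H.weight_pos).ne' ?_
    linear_combination 3 * q ^ 4 * (q - p) * k3 + 3 * (q - p) * p ^ 2 * k4
      - (q - p) * (q ^ 2 + e * r + p ^ 2 * r ^ 2) * k2
  generalize (N p (π 0) (π 1) (π 2)).eval (z₃ p q) = w at k5 ⊢
  rw [hD, k6, z₃, neg_div, div_mul_div_comm, div_div_eq_mul_div]
  rw [← neg_div, div_eq_div_iff (by positivity) (by positivity)]
  linear_combination -3 * q ^ 4 * k5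

/-! ### Geometric expansion of the generating function -/

theorem mk_pow_mul_one_sub (a : ℂ) :
    PowerSeries.mk (fun n => a ^ n) * (1 - PowerSeries.C a * PowerSeries.X) = 1 := by
  ext n
  rw [mul_sub, mul_one, map_sub, mul_left_comm, PowerSeries.coeff_C_mul, PowerSeries.coeff_mk]
  cases n with
  | zero => simp
  | succ n =>
    rw [PowerSeries.coeff_succ_mul_X, PowerSeries.coeff_mk, PowerSeries.coeff_one]
    simp [pow_succ']

theorem coeff_mk_pow_mul (a b : ℂ) (n : ℕ) :
    PowerSeries.coeff n (PowerSeries.mk (fun n => a ^ n) * PowerSeries.mk (fun n => b ^ n))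
      = ∑ k ∈ Finset.range (n + 1), a ^ k * b ^ (n - k) := by
  rw [PowerSeries.coeff_mul, Finset.Nat.sum_antidiagonal_eq_sum_range_succ_mk]
  simp only [PowerSeries.coeff_mk]

theorem hasSum_sum_range_pow {a b : ℂ} (ha : ‖a‖ < 1) (hb : ‖b‖ < 1) :
    HasSum (fun n => ∑ k ∈ Finset.range (n + 1), a ^ k * b ^ (n - k))
      ((1 - a)⁻¹ * (1 - b)⁻¹) := by
  have ha' : Summable fun n => ‖a ^ n‖ := by
    simpa using summable_geometric_of_lt_one (norm_nonneg a) ha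
  have hb' : Summable fun n => ‖b ^ n‖ := by
    simpa using summable_geometric_of_lt_one (norm_nonneg b) hb
  rw [← tsum_geometric_of_norm_lt_one ha, ← tsum_geometric_of_norm_lt_one hb,
    tsum_mul_tsum_eq_tsum_sum_range_of_summable_norm ha' hb']
  exact (summable_norm_sum_mul_range_of_summable_norm ha' hb').of_norm.hasSum

theorem map_num_eq (hp : 0 < p) (hpq : p < q) {x₀ x₁ x₂ : ℝ}
    (h : aeval (z₁ p q) (num p q x₀ x₁ x₂) = 0) :
    ∃ κ : ℂ, q ^ 6 * x₀ = κ * (z₁ p q * z₂ p q) ∧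
      (num p q x₀ x₁ x₂).map (algebraMap ℝ ℂ)
        = C κ * ((X - C (z₁ p q)) * (X - C (z₂ p q))) := by
  obtain ⟨κ, h2, h1, h0⟩ := num_coeff_of_aeval_eq_zero hp hpq h
  have e1 : ((‖z₁ p q‖ ^ 2 : ℝ) : ℂ) = z₁ p q * z₂ p q := by
    rw [z₂_eq_conj hp (hp.trans hpq), Complex.mul_conj, Complex.normSq_eq_norm_sq]
  have e2 : ((2 * (z₁ p q).re : ℝ) : ℂ) = z₁ p q + z₂ p q := by
    rw [z₂_eq_conj hp (hp.trans hpq), Complex.add_conj]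
  refine ⟨κ, ?_, ?_⟩
  · rw [← e1]
    exact_mod_cast h0
  · rw [num, h2, h1, h0]
    simp only [Polynomial.map_add, Polynomial.map_mul, Polynomial.map_pow, Polynomial.map_C,
      Polynomial.map_X, Complex.coe_algebraMap]
    rw [Complex.ofReal_mul, Complex.ofReal_mul (-κ), Complex.ofReal_neg, e1, e2]
    simp only [map_mul, map_add, map_neg]
    ring

/-- The generating function of a stationary distribution, in factored form. -/
theorem prod_mul_mk (hp : 0 < p) (hpq : p < q) (hsum : p + q = 1)
    (h : IsStationary (P p q) π) :
    (1 - PowerSeries.C ((p ^ 2 / q ^ 2 : ℝ) : ℂ) * PowerSeries.X)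
      * (1 - PowerSeries.C (((p ^ 2 / q ^ 2 : ℝ) : ℂ) * z₁ p q) * PowerSeries.X)
      * (1 - PowerSeries.C (((p ^ 2 / q ^ 2 : ℝ) : ℂ) * z₂ p q) * PowerSeries.X)
      * PowerSeries.mk (fun j => (π j : ℂ)) = PowerSeries.C (π 0 : ℂ) := by
  have hq := hp.trans hpq
  have hp' : (p : ℂ) ≠ 0 := Complex.ofReal_ne_zero.2 hp.ne'
  have hq' : (q : ℂ) ≠ 0 := Complex.ofReal_ne_zero.2 hq.ne'
  obtain ⟨κ, hκ, hnum⟩ := map_num_eq hp hpq (aeval_num_z₁ hp hpq hsum h)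
  have h1 := congrArg (PowerSeries.map (algebraMap ℝ ℂ)) (D_mul_mk_eq_num hsum h.invariant)
  have h2 : PowerSeries.map (algebraMap ℝ ℂ) (PowerSeries.mk π)
      = PowerSeries.mk (fun j => (π j : ℂ)) := by
    ext j; simp
  rw [map_mul, ← polynomial_map_coe, ← polynomial_map_coe, hnum, map_D_eq hp hq, h2] at h1
  simp only [coe_mul, coe_sub, coe_C, coe_X] at h1
  have e4 := z₁_mul_z₄ q hp.ne'
  have e5 : (p : ℂ) ^ 2 * (z₂ p q * z₅ p q) = q ^ 2 := by
    have := congrArg (starRingEnd ℂ) e4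
    simpa only [map_mul, Complex.conj_ofReal, map_pow, ← z₂_eq_conj hp hq, ← z₅_eq_conj hp hq]
      using this
  have e3 : (p : ℂ) ^ 2 * ((z₃ p q : ℝ) : ℂ) = q ^ 2 := by
    rw [z₃]; push_cast; field_simp
  have hζ : (q : ℂ) ^ 2 * ((p ^ 2 / q ^ 2 : ℝ) : ℂ) = p ^ 2 := by
    push_cast; field_simp
  generalize ((p ^ 2 / q ^ 2 : ℝ) : ℂ) = ζ at *
  have hX : ∀ z : ℂ, (PowerSeries.X - PowerSeries.C z : PowerSeries ℂ) ≠ 0 := fun z h0 => by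
    simpa using congrArg (PowerSeries.coeff 1) h0
  have h3 := mul_left_cancel₀ (mul_ne_zero (hX (z₁ p q)) (hX (z₂ p q)))
    (show (PowerSeries.X - PowerSeries.C (z₁ p q)) * (PowerSeries.X - PowerSeries.C (z₂ p q))
      * (PowerSeries.C (-(p : ℂ) ^ 6) * ((PowerSeries.X - PowerSeries.C ((z₃ p q : ℝ) : ℂ))
        * (PowerSeries.X - PowerSeries.C (z₄ p q)) * (PowerSeries.X - PowerSeries.C (z₅ p q)))
        * PowerSeries.mk (fun j => (π j : ℂ)))
      = (PowerSeries.X - PowerSeries.C (z₁ p q)) * (PowerSeries.X - PowerSeries.C (z₂ p q))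
      * PowerSeries.C κ by linear_combination h1)
  -- Roots pair up with product `q² / p²`, so `1 / b = ζ a`: the pairs are `(z₁, z₄)`, `(z₂, z₅)`
  -- and `(1, z₃)`.
  have f : ∀ a b : ℂ, (p : ℂ) ^ 2 * (a * b) = q ^ 2 →
      PowerSeries.C ((q : ℂ) ^ 2) * (1 - PowerSeries.C (ζ * a) * PowerSeries.X)
        = -PowerSeries.C (p ^ 2 * a) * (PowerSeries.X - PowerSeries.C b) := fun a b hab => by
    have k1 : PowerSeries.C ((q : ℂ) ^ 2) * PowerSeries.C (ζ * a)
        = PowerSeries.C ((p : ℂ) ^ 2 * a) := by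
      rw [← map_mul, ← mul_assoc, hζ]
    have k2 : PowerSeries.C ((p : ℂ) ^ 2 * a) * PowerSeries.C b = PowerSeries.C ((q : ℂ) ^ 2) := by
      rw [← map_mul, mul_assoc, hab]
    linear_combination -PowerSeries.X * k1 - k2
  have f1 := f (z₁ p q) _ e4
  have f2 := f (z₂ p q) _ e5
  have f3 := f 1 _ (by rw [one_mul]; exact e3)
  rw [mul_one, mul_one] at f3
  have hC : PowerSeries.C ((q : ℂ) ^ 6) ≠ 0 := by
    rw [Ne, map_eq_zero]
    exact pow_ne_zero 6 hq'
  refine mul_left_cancel₀ hC ?_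
  calc PowerSeries.C ((q : ℂ) ^ 6) * ((1 - PowerSeries.C ζ * PowerSeries.X)
        * (1 - PowerSeries.C (ζ * z₁ p q) * PowerSeries.X)
        * (1 - PowerSeries.C (ζ * z₂ p q) * PowerSeries.X)
        * PowerSeries.mk (fun j => (π j : ℂ)))
      = (PowerSeries.C ((q : ℂ) ^ 2) * (1 - PowerSeries.C ζ * PowerSeries.X))
        * (PowerSeries.C ((q : ℂ) ^ 2) * (1 - PowerSeries.C (ζ * z₁ p q) * PowerSeries.X))
        * (PowerSeries.C ((q : ℂ) ^ 2) * (1 - PowerSeries.C (ζ * z₂ p q) * PowerSeries.X))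
        * PowerSeries.mk (fun j => (π j : ℂ)) := by
        simp only [map_pow]; ring
    _ = PowerSeries.C (z₁ p q * z₂ p q)
        * (PowerSeries.C (-(p : ℂ) ^ 6) * ((PowerSeries.X - PowerSeries.C ((z₃ p q : ℝ) : ℂ))
        * (PowerSeries.X - PowerSeries.C (z₄ p q)) * (PowerSeries.X - PowerSeries.C (z₅ p q)))
        * PowerSeries.mk (fun j => (π j : ℂ))) := by
        rw [f1, f2, f3]; simp only [map_pow, map_mul, map_neg]; ring
    _ = PowerSeries.C ((q : ℂ) ^ 6) * PowerSeries.C (π 0 : ℂ) := by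
        rw [h3, ← map_mul, ← map_mul, hκ, mul_comm]

/-- Expanding the three geometric series gives partial sums of the complete homogeneous polynomials
in `z₁`, `z₂`; these sums converge because both roots lie in the open disk. -/
theorem eq_pow_mul_sum (hp : 0 < p) (hpq : p < q) (hsum : p + q = 1)
    (h : IsStationary (P p q) π) (j : ℕ) :
    (π j : ℂ) = ((p ^ 2 / q ^ 2 : ℝ) : ℂ) ^ j * (π 0 * ∑ i ∈ Finset.range (j + 1),
      ∑ k ∈ Finset.range (i + 1), z₁ p q ^ k * z₂ p q ^ (i - k)) := by
  have h1 := prod_mul_mk hp hpq hsum h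
  generalize ((p ^ 2 / q ^ 2 : ℝ) : ℂ) = ζ at *
  have h2 : PowerSeries.mk (fun j => (π j : ℂ)) = PowerSeries.C (π 0 : ℂ)
      * ((PowerSeries.mk (fun n => (ζ * z₁ p q) ^ n) * PowerSeries.mk (fun n => (ζ * z₂ p q) ^ n))
        * PowerSeries.mk (fun n => ζ ^ n)) := by
    rw [← h1]
    calc PowerSeries.mk (fun j => (π j : ℂ))
        = (PowerSeries.mk (fun n => ζ ^ n) * (1 - PowerSeries.C ζ * PowerSeries.X))
          * (PowerSeries.mk (fun n => (ζ * z₁ p q) ^ n)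
            * (1 - PowerSeries.C (ζ * z₁ p q) * PowerSeries.X))
          * (PowerSeries.mk (fun n => (ζ * z₂ p q) ^ n)
            * (1 - PowerSeries.C (ζ * z₂ p q) * PowerSeries.X))
          * PowerSeries.mk (fun j => (π j : ℂ)) := by
          rw [mk_pow_mul_one_sub, mk_pow_mul_one_sub, mk_pow_mul_one_sub, one_mul, one_mul, one_mul]
      _ = _ := by ring
  have h3 := congrArg (PowerSeries.coeff j) h2
  rw [PowerSeries.coeff_mk, PowerSeries.coeff_C_mul, PowerSeries.coeff_mul,
    Finset.Nat.sum_antidiagonal_eq_sum_range_succ_mk] at h3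
  rw [h3, mul_left_comm, Finset.mul_sum _ _ (ζ ^ j)]
  congr 1
  refine Finset.sum_congr rfl fun i hi => ?_
  rw [coeff_mk_pow_mul, PowerSeries.coeff_mk, Finset.sum_mul, Finset.mul_sum]
  refine Finset.sum_congr rfl fun k hk => ?_
  rw [Finset.mem_range] at hi hk
  rw [show j = k + (i - k) + (j - i) by omega, pow_add, pow_add, mul_pow, mul_pow,
    show k + (i - k) + (j - i) - i = j - i by omega]
  ring

theorem tendsto_div_pow (hp : 0 < p) (hpq : p < q) (hsum : p + q = 1)
    (h : IsStationary (P p q) π) :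
    Filter.Tendsto (fun j => π j / (p ^ 2 / q ^ 2) ^ j) Filter.atTop (nhds (amp p q)) := by
  have hq := hp.trans hpq
  obtain ⟨H, hre⟩ := isParam_z₁ hp hpq hsum
  have hz1 := norm_z₁_lt_one hp hpq hsum
  have hz2 : ‖z₂ p q‖ < 1 := by rwa [z₂_eq_conj hp hq, Complex.norm_conj]
  have h1 := ((hasSum_sum_range_pow hz1 hz2).tendsto_sum_nat.comp
    (Filter.tendsto_add_atTop_nat 1)).const_mul (π 0 : ℂ)
  have h2 : (π 0 : ℂ) * ((1 - z₁ p q)⁻¹ * (1 - z₂ p q)⁻¹) = (amp p q : ℂ) := by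
    have e1 : (1 - z₁ p q) * (1 - z₂ p q)
        = ((1 - 2 * (z₁ p q).re + ‖z₁ p q‖ ^ 2 : ℝ) : ℂ) := by
      rw [z₂_eq_conj hp hq, ← Complex.normSq_eq_norm_sq]
      have e0 := Complex.add_conj (z₁ p q)
      push_cast at e0 ⊢
      rw [← Complex.mul_conj]
      linear_combination -e0
    have e2 : p ^ 2 * (1 - 2 * (z₁ p q).re + ‖z₁ p q‖ ^ 2)
        = p ^ 2 + (θ p q - 1) / 2 * (p / q * ‖z₁ p q‖) + q ^ 2 * (p / q * ‖z₁ p q‖) ^ 2 := by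
      have : q * (p / q * ‖z₁ p q‖) = p * ‖z₁ p q‖ := by field_simp
      rw [← mul_pow, this]
      linear_combination -hre
    have e3 := H.weight_pos
    have e4 := H.amp_mul
    rw [← e2] at e3 e4
    have e5 : 0 < 1 - 2 * (z₁ p q).re + ‖z₁ p q‖ ^ 2 :=
      (mul_pos_iff_of_pos_left (pow_pos hp 2)).1 e3
    rw [← mul_inv, e1, ← Complex.ofReal_inv, ← Complex.ofReal_mul, (h.eq_val hp hpq hsum).1,
      ← div_eq_mul_inv]
    congr 1
    rw [div_eq_iff e5.ne']
    refine mul_left_cancel₀ (pow_ne_zero 2 hp.ne') ?_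
    linear_combination -e4
  rw [h2] at h1
  have h3 := (Complex.continuous_re.tendsto _).comp h1
  rw [Complex.ofReal_re] at h3
  refine h3.congr fun j => ?_
  have hζ : p ^ 2 / q ^ 2 ≠ 0 := by positivity
  have h4 := eq_pow_mul_sum hp hpq hsum h j
  rw [eq_div_iff (pow_ne_zero _ hζ)]
  have h5 := congrArg Complex.re h4
  rw [Complex.ofReal_re, ← Complex.ofReal_pow, Complex.re_ofReal_mul] at h5
  rw [h5, mul_comm]
  rfl

theorem amp_pos (hp : 0 < p) (hpq : p < q) (hsum : p + q = 1) : 0 < amp p q := by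
  obtain ⟨H, -⟩ := isParam_z₁ hp hpq hsum
  have hq := hp.trans hpq
  have h1 := H.amp_mul
  have h2 := H.val0_eq'
  have h3 := H.weight_pos
  have he := H.e_pos
  have hr := H.r_pos
  have hd := sub_pos.2 hpq
  have h4 : 0 < val0 p q := by
    refine (mul_pos_iff_of_pos_left (pow_pos hq 4)).1 ?_
    rw [h2]
    positivity
  refine (mul_pos_iff_of_pos_right h3).1 ?_
  rw [h1]
  positivity

theorem isEquivalent_amp (hp : 0 < p) (hpq : p < q) (hsum : p + q = 1)
    (h : IsStationary (P p q) π) :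
    Asymptotics.IsEquivalent Filter.atTop π (fun j : ℕ => amp p q * (p ^ 2 / q ^ 2) ^ j) := by
  have hq := hp.trans hpq
  have ha := amp_pos hp hpq hsum
  refine Asymptotics.isEquivalent_of_tendsto_one ?_
  have h1 := (tendsto_div_pow hp hpq hsum h).div_const (amp p q)
  rw [div_self ha.ne'] at h1
  refine h1.congr fun j => ?_
  rw [Pi.div_apply, div_div, mul_comm]

end Stationary

end TrafficLight

/-! ### The main theorem -/

theorem mainTheorem3 (p q : ℝ) (hp : 0 < p) (hpq : p < q) (hsum : p + q = 1) :
    -- the five zeros of the denominator, with multiplicity, and their location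
    ((TrafficLight.D p q).natDegree = 5 ∧
      (TrafficLight.D p q).aroots ℂ =
        {TrafficLight.z₁ p q, TrafficLight.z₂ p q, ((TrafficLight.z₃ p q : ℝ) : ℂ),
          TrafficLight.z₄ p q, TrafficLight.z₅ p q} ∧
      TrafficLight.z₂ p q = (starRingEnd ℂ) (TrafficLight.z₁ p q) ∧
      TrafficLight.z₅ p q = (starRingEnd ℂ) (TrafficLight.z₄ p q) ∧
      (TrafficLight.z₁ p q).im ≠ 0 ∧ (TrafficLight.z₄ p q).im ≠ 0 ∧
      ‖TrafficLight.z₁ p q‖ < 1 ∧ ‖TrafficLight.z₂ p q‖ < 1 ∧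
      1 < TrafficLight.z₃ p q ∧
      1 < ‖TrafficLight.z₄ p q‖ ∧ 1 < ‖TrafficLight.z₅ p q‖) ∧
    -- the two zeros inside the unit disk and the normalization determine the three values
    (∀ x₀ x₁ x₂ : ℝ,
      (Polynomial.aeval (TrafficLight.z₁ p q) (TrafficLight.N p x₀ x₁ x₂) = 0 ∧
        Polynomial.aeval (TrafficLight.z₂ p q) (TrafficLight.N p x₀ x₁ x₂) = 0 ∧
        x₀ + x₁ + x₂ + TrafficLight.L p q x₀ x₁ x₂ = 1) ↔
      (x₀ = TrafficLight.val0 p q ∧ x₁ = TrafficLight.val1 p q ∧ x₂ = TrafficLight.val2 p q)) ∧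
    -- the stationary distribution exists, is unique, and is described as follows
    (∃! π : ℕ → ℝ, TrafficLight.IsStationary (TrafficLight.P p q) π) ∧
    (∀ π : ℕ → ℝ, TrafficLight.IsStationary (TrafficLight.P p q) π →
      (∀ z : ℂ, ‖z‖ ≤ 1 → Polynomial.aeval z (TrafficLight.D p q) ≠ 0 →
        HasSum (fun j : ℕ => (π (j + 3) : ℂ) * z ^ (j + 3))
          (Polynomial.aeval z (TrafficLight.N p (π 0) (π 1) (π 2)) /
            Polynomial.aeval z (TrafficLight.D p q))) ∧
      Filter.Tendsto (fun x : ℝ => ∑' j : ℕ, π (j + 3) * x ^ (j + 3))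
        (nhdsWithin 1 (Set.Iio 1)) (nhds (TrafficLight.L p q (π 0) (π 1) (π 2))) ∧
      π 0 = TrafficLight.val0 p q ∧
      π 1 = TrafficLight.val1 p q ∧
      π 2 = TrafficLight.val2 p q ∧
      -(TrafficLight.N p (π 0) (π 1) (π 2)).eval (TrafficLight.z₃ p q) /
          (TrafficLight.z₃ p q *
            (Polynomial.derivative (TrafficLight.D p q)).eval (TrafficLight.z₃ p q)) =
        TrafficLight.amp p q ∧
      Asymptotics.IsEquivalent Filter.atTop π
        (fun j : ℕ => TrafficLight.amp p q * (p ^ 2 / q ^ 2) ^ j)) := by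
  have hq : 0 < q := hp.trans hpq
  have hz₂ := TrafficLight.z₂_eq_conj hp hq
  have hz₅ := TrafficLight.z₅_eq_conj hp hq
  have h₁ := TrafficLight.norm_z₁_lt_one hp hpq hsum
  have h₄ := TrafficLight.one_lt_norm_z₄ hp hpq hsum
  obtain ⟨π, hπ⟩ := TrafficLight.exists_isStationary hp hpq hsum
  refine ⟨⟨TrafficLight.natDegree_D hp hq, TrafficLight.aroots_D hp hq, hz₂, hz₅,
    TrafficLight.im_ne_zero_of_quadratic hq.ne' (TrafficLight.z₁_quadratic q hp.ne'),
    TrafficLight.im_ne_zero_of_quadratic hq.ne' (TrafficLight.z₄_quadratic q hp.ne'),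
    h₁, by rwa [hz₂, Complex.norm_conj], TrafficLight.one_lt_z₃ hp hpq, h₄,
    by rwa [hz₅, Complex.norm_conj]⟩, fun x₀ x₁ x₂ => ⟨?_, ?_⟩,
    ⟨π, hπ, fun π' hπ' => hπ'.unique hp hpq hsum hπ⟩, fun π hπ => ?_⟩
  · rintro ⟨h1, -, h3⟩
    rw [TrafficLight.aeval_N hsum, TrafficLight.aeval_D_z₁ hp hq, zero_mul, sub_zero] at h1
    exact TrafficLight.eq_val_of_aeval_num hp hpq hsum h1 h3
  -- The displayed values solve the system because the stationary distribution already constructed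
  -- takes them.
  · obtain ⟨e0, e1, e2⟩ := hπ.eq_val hp hpq hsum
    rintro ⟨rfl, rfl, rfl⟩
    rw [TrafficLight.aeval_N hsum, TrafficLight.aeval_D_z₁ hp hq, zero_mul, sub_zero,
      TrafficLight.aeval_N hsum, TrafficLight.aeval_D_z₂ hp hq, zero_mul, sub_zero, ← e0, ← e1,
      ← e2]
    exact ⟨TrafficLight.aeval_num_z₁ hp hpq hsum hπ, TrafficLight.aeval_num_z₂ hp hpq hsum hπ,
      TrafficLight.normalization hpq hsum hπ⟩
  · obtain ⟨e0, e1, e2⟩ := hπ.eq_val hp hpq hsum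
    exact ⟨fun z hz hD => TrafficLight.hasSum_tail hsum hπ hz hD,
      TrafficLight.tendsto_tail hpq hsum hπ, e0, e1, e2,
      TrafficLight.residue_eq_amp hp hpq hsum hπ, TrafficLight.isEquivalent_amp hp hpq hsum hπ⟩
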